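/- Let $0<q<1$, let $v>-1$ be real and let $n,m,k\in\mathbb{Z}$. Write $(a;p)_i=\prod_{r=0}^{i-1}(1-ap^{r})$ and $(a;p)_\infty=\prod_{r\ge 0}(1-ap^{r})$, and let $\int_0^\infty f(t)\,d_qt=(1-q)\sum_{r\in\mathbb{Z}}q^{r}f(q^{r})$ be Jackson's $q$-integral. For $0<p<1$ and $x>0$ let $$J_\alpha(x,p)=\frac{x^{\alpha}}{(p;p)_\infty}\sum_{r=0}^{\infty}(-1)^r\frac{p^{r(r+1)/2}\,(p^{\alpha+1+r};p)_\infty}{(p;p)_r}\,x^{2r}\qquad(\alpha\in\mathbb{R})$$ be the Hahn--Exton $q$-Bessel function, and for $\alpha>-1$ let $$j_\alpha(x,p)=\sum_{r=0}^{\infty}(-1)^r\frac{p^{r(r+1)/2}}{(p;p)_r\,(p^{\alpha+1};p)_r}\,x^{2r},\qquad c_{q,\alpha}=\frac{1}{1-q}\,\frac{(q^{2\alpha+2};q^2)_\infty}{(q^2;q^2)_\infty}.$$ For $x,y,z\in\{q^r : r\in\mathbb{Z}\}$ let $$D_v(x,y,z)=c_{q,v}^2\int_0^\infty j_v(xt,q^2)\,j_v(yt,q^2)\,j_v(zt,q^2)\,t^{2v+1}\,d_qt$$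 be the kernel of the $q$-Bessel translation operator, and let $$E_{v,v}(q^m,q^n,q^k)=\frac{1}{(1-q)^2\,c_{q,v}\,c_{q,0}}\;q^{-k(v+2)-mv}\,J_{n-k}(q^{m-k},q^2)\,J_{v+n-k}(q^{m-k},q^2)$$ be the Graf kernel $E_{v,x}$ at $x=v$. Then the $q$-integrals defining $D_v(q^m,q^{i+n},q^k)$, $i\ge 0$, converge absolutely, the series below converges absolutely, and $$E_{v,v}(q^m,q^n,q^k)=(1-q)\sum_{i=0}^{\infty}\frac{(q^{-2v};q^2)_i}{(q^2;q^2)_i}\,q^{i(2+2v)}\,D_v(q^m,q^{i+n},q^k).$$ -/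

import Mathlib

noncomputable section

namespace QBessel

/-- The finite `q`-shifted factorial `(a; p)_n = ∏_{i < n} (1 - a p ^ i)`. -/
def qPoch (a p : ℝ) (n : ℕ) : ℝ := ∏ i ∈ Finset.range n, (1 - a * p ^ i)

/-- The infinite `q`-shifted factorial `(a; p)_∞ = ∏_{i ≥ 0} (1 - a p ^ i)`,
which converges for `|p| < 1`. -/
def qPochInf (a p : ℝ) : ℝ := ∏' i : ℕ, (1 - a * p ^ i)

/-- A function is integrable for Jackson's `q`-integral over `[0, ∞)` if the series defining
the `q`-integral converges absolutely. -/
def JacksonIntegrable (q : ℝ) (f : ℝ → ℝ) : Prop :=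
  Summable fun n : ℤ => q ^ n * f (q ^ n)

/-- Jackson's `q`-integral `∫_0^∞ f(t) d_q t = (1 - q) ∑_{n ∈ ℤ} q ^ n f(q ^ n)`. -/
def jacksonIntegral (q : ℝ) (f : ℝ → ℝ) : ℝ :=
  (1 - q) * ∑' n : ℤ, q ^ n * f (q ^ n)

/-- The Hahn-Exton `q`-Bessel function `J_v(x, p)` of real order `v` at `x > 0`, in base `p`:
`x ^ v / (p; p)_∞ * ∑_r (-1)^r p^{r(r+1)/2} (p^{v+1+r}; p)_∞ / (p; p)_r * x^{2r}`.
Since `(p^{v+1}; p)_∞ = (p^{v+1}; p)_r (p^{v+1+r}; p)_∞`, this is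
`(p^{v+1}; p)_∞ / (p; p)_∞ * x ^ v * ₁φ₁(0; p^{v+1}; p, p x²)` whenever the latter is defined;
absorbing the prefactor into the series gives the usual meaning at negative integer orders, where
denominators of `₁φ₁` vanish. The natural number division `r * (r + 1) / 2` is exact. -/
def hahnExtonJ (v x p : ℝ) : ℝ :=
  x ^ v / qPochInf p p *
    ∑' r : ℕ, (-1) ^ r * (p ^ (r * (r + 1) / 2) * qPochInf (p ^ (v + 1 + (r : ℝ))) p
      / qPoch p p r) * x ^ (2 * r)

/-- The normalized Hahn-Exton `q`-Bessel function
`j_v(x, p) = ₁φ₁(0; p^{v+1}; p, p x²)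
= ∑_r (-1)^r p^{r(r+1)/2} / ((p; p)_r (p^{v+1}; p)_r) * x^{2r}`, for `v > -1`. -/
def normalizedJ (v x p : ℝ) : ℝ :=
  ∑' r : ℕ, (-1) ^ r * (p ^ (r * (r + 1) / 2)
    / (qPoch p p r * qPoch (p ^ (v + 1)) p r)) * x ^ (2 * r)

/-- The constant `c_{q,v} = (q^{2v+2}; q²)_∞ / ((1 - q) (q²; q²)_∞)`. -/
def cConst (q v : ℝ) : ℝ :=
  1 / (1 - q) * (qPochInf (q ^ (2 * v + 2)) (q ^ 2) / qPochInf (q ^ 2) (q ^ 2))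

/-- The integrand `t ↦ j_v(xt, q²) j_v(yt, q²) j_v(zt, q²) t^{2v+1}` of the kernel `D_v`. -/
def kernelIntegrand (q v x y z t : ℝ) : ℝ :=
  normalizedJ v (x * t) (q ^ 2) * normalizedJ v (y * t) (q ^ 2) *
    normalizedJ v (z * t) (q ^ 2) * t ^ (2 * v + 1)

/-- The kernel of the `q`-translation operator,
`D_v(x, y, z) = c_{q,v}² ∫_0^∞ j_v(xt, q²) j_v(yt, q²) j_v(zt, q²) t^{2v+1} d_q t`. -/
def translationKernel (q v x y z : ℝ) : ℝ :=
  cConst q v ^ 2 * jacksonIntegral q (kernelIntegrand q v x y z)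

/-- The Graf kernel, as a function of the integer exponents: `grafKernel q v x m z k` is
`E_{v,x}(q^m, q^z, q^k) = ((1-q)² c_{q,v} c_{q,x-v})⁻¹ q^{-k(x+2) - mv - z(x-v)}
J_{z-k}(q^{x-v+m-k}, q²) J_{v+z-k}(q^{m-k}, q²)`. -/
def grafKernel (q v x : ℝ) (m z k : ℤ) : ℝ :=
  1 / ((1 - q) ^ 2 * cConst q v * cConst q (x - v)) *
    q ^ (-(k : ℝ) * (x + 2) - (m : ℝ) * v - (z : ℝ) * (x - v)) *
    hahnExtonJ ((z : ℝ) - (k : ℝ)) (q ^ (x - v + (m : ℝ) - (k : ℝ))) (q ^ 2) *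
    hahnExtonJ (v + (z : ℝ) - (k : ℝ)) (q ^ ((m : ℝ) - (k : ℝ))) (q ^ 2)

end QBessel

end

/-! Write `N` for `besselNorm q v`, so that `c_{q,v} = N/(1-q)`. Three facts carry the proof. (1)
Symmetry (`hahnExtonJ_zpow`): order and exponent of the argument may be exchanged, `J_α(q^β, q²) =
J_β(q^α, q²)` for integer `β`. On the grid `q^ℤ`, functions of real order `v` thus become functions
of integer order at the fixed point `x = q^v`. (2) A `q`-Sonine sum
(`tsum_sonineCoeff_mul_normalizedJ`): the weights of the theorem turn `j_v(q^i y)` into `N⁻¹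
j_0(y)`; power by power in `y` this is the `q`-binomial theorem. (3) A product formula
(`tsum_besselInt_mul_besselInt_mul_besselInt_zero`): `∑_r q^{2r} J_{m+r}(x) J_r(x) J_0(y q^r) =
J_m(xy) J_m(y)` when `qx < 1`. Absolute convergence allows the sum over `i` to pass inside the
`q`-integral. There (2) replaces one factor of order `v` by one of order `0`, and (3) at `x = q^v`,
where `qx < 1` means `v > -1`, gives a product of two Bessel functions, which by (1) is the Graf
kernel. For (3), `J_0` is expanded in powers `y^{2B}`. The resulting moments are coefficients of a
product of four infinite products (from the generating function of `J_n`), which regroup in pairs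
into `q`-binomial polynomials with explicit coefficients. -/

open Filter Topology

namespace QBessel

/-! ### Shifted factorials and the `q`-binomial theorem. -/

section InfiniteProducts

variable {p : ℝ}

lemma qPoch_zero (a p : ℝ) : qPoch a p 0 = 1 := by simp [qPoch]

lemma qPoch_succ (a p : ℝ) (n : ℕ) : qPoch a p (n + 1) = qPoch a p n * (1 - a * p ^ n) := by
  simp [qPoch, Finset.prod_range_succ]

lemma qPoch_succ' (a p : ℝ) (n : ℕ) : qPoch a p (n + 1) = (1 - a) * qPoch (a * p) p n := by
  simp only [qPoch, Finset.prod_range_succ', pow_zero, mul_one]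
  rw [mul_comm]
  congr 1
  exact Finset.prod_congr rfl fun i _ => by ring

lemma summable_norm_neg_mul_pow (hp0 : 0 ≤ p) (hp1 : p < 1) (a : ℝ) :
    Summable fun i : ℕ => ‖-(a * p ^ i)‖ := by
  simpa [abs_mul, abs_of_nonneg hp0] using
    (summable_geometric_of_lt_one hp0 hp1).mul_left |a|

lemma multipliable_qPochInf (hp0 : 0 ≤ p) (hp1 : p < 1) (a : ℝ) :
    Multipliable fun i : ℕ => 1 - a * p ^ i := by
  simpa [sub_eq_add_neg] using multipliable_one_add_of_summable
    (summable_norm_neg_mul_pow hp0 hp1 a)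

lemma tendsto_qPoch (hp0 : 0 ≤ p) (hp1 : p < 1) (a : ℝ) :
    Tendsto (qPoch a p) atTop (𝓝 (qPochInf a p)) :=
  (multipliable_qPochInf hp0 hp1 a).hasProd.tendsto_prod_nat

lemma qPochInf_eq_mul (hp0 : 0 ≤ p) (hp1 : p < 1) (a : ℝ) :
    qPochInf a p = (1 - a) * qPochInf (a * p) p := by
  refine tendsto_nhds_unique ((tendsto_qPoch hp0 hp1 a).comp (tendsto_add_atTop_nat 1)) ?_
  refine ((tendsto_qPoch hp0 hp1 (a * p)).const_mul (1 - a)).congr fun n => ?_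
  simp [qPoch_succ']

lemma qPochInf_eq_qPoch_mul (hp0 : 0 ≤ p) (hp1 : p < 1) (a : ℝ) (n : ℕ) :
    qPochInf a p = qPoch a p n * qPochInf (a * p ^ n) p := by
  induction n with
  | zero => simp [qPoch_zero]
  | succ n ih => rw [ih, qPoch_succ, qPochInf_eq_mul hp0 hp1 (a * p ^ n)]; ring_nf

lemma qPochInf_ne_zero (hp0 : 0 ≤ p) (hp1 : p < 1) {a : ℝ} (ha0 : 0 ≤ a) (ha1 : a < 1) :
    qPochInf a p ≠ 0 := by
  have := tprod_one_add_ne_zero_of_summable (f := fun i : ℕ => -(a * p ^ i)) (fun i => ?_)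
    (summable_norm_neg_mul_pow hp0 hp1 a)
  · simpa [qPochInf, sub_eq_add_neg] using this
  · have : a * p ^ i ≤ a := mul_le_of_le_one_right ha0 (pow_le_one₀ hp0 hp1.le)
    rw [← sub_eq_add_neg]
    linarith

lemma qPoch_ne_zero (hp0 : 0 ≤ p) (hp1 : p < 1) {a : ℝ} (ha0 : 0 ≤ a) (ha1 : a < 1) (n : ℕ) :
    qPoch a p n ≠ 0 := by
  intro h
  have := qPochInf_ne_zero hp0 hp1 ha0 ha1
  rw [qPochInf_eq_qPoch_mul hp0 hp1 a n, h, zero_mul] at this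
  exact this rfl

lemma exists_abs_le_of_tendsto {f : ℕ → ℝ} {l : ℝ} (h : Tendsto f atTop (𝓝 l)) :
    ∃ C, 0 ≤ C ∧ ∀ n, |f n| ≤ C := by
  obtain ⟨C, hC⟩ := (Metric.isBounded_range_of_tendsto f h).exists_norm_le
  exact ⟨C, (norm_nonneg _).trans (hC _ ⟨0, rfl⟩), fun n => hC _ ⟨n, rfl⟩⟩

lemma exists_abs_qPoch_div_le (hp0 : 0 ≤ p) (hp1 : p < 1) (a : ℝ) :
    ∃ C, 0 ≤ C ∧ ∀ n, |qPoch a p n / qPoch p p n| ≤ C :=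
  exists_abs_le_of_tendsto ((tendsto_qPoch hp0 hp1 a).div (tendsto_qPoch hp0 hp1 p)
    (qPochInf_ne_zero hp0 hp1 hp0 hp1))

/-- The `q`-binomial theorem. -/
lemma tsum_qPoch_div_mul_pow (hp0 : 0 < p) (hp1 : p < 1) (a : ℝ) {z : ℝ} (hz0 : 0 ≤ z)
    (hz1 : z < 1) :
    ∑' i : ℕ, qPoch a p i / qPoch p p i * z ^ i = qPochInf (a * z) p / qPochInf z p := by
  obtain ⟨C, hC0, hC⟩ := exists_abs_qPoch_div_le hp0.le hp1 a
  set c : ℕ → ℝ := fun i => qPoch a p i / qPoch p p i with hc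
  have hcrec : ∀ i, c (i + 1) * (1 - p ^ (i + 1)) = c i * (1 - a * p ^ i) := by
    intro i
    have h1 := qPoch_ne_zero hp0.le hp1 hp0.le hp1 i
    have h2 := qPoch_ne_zero hp0.le hp1 hp0.le hp1 (i + 1)
    have h3 : (1 - p ^ (i + 1)) ≠ 0 := by
      have : p ^ (i + 1) < 1 := pow_lt_one₀ hp0.le hp1 (by simp)
      linarith
    have h4 : 1 - p * p ^ i ≠ 0 := by rwa [pow_succ'] at h3
    simp only [hc]
    rw [qPoch_succ] at h2
    rw [qPoch_succ, qPoch_succ, pow_succ', div_mul_eq_mul_div, mul_div_mul_right _ _ h4,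
      div_mul_eq_mul_div]
  have hsum : ∀ w : ℝ, 0 ≤ w → w < 1 → Summable fun i => c i * w ^ i := fun w hw0 hw1 =>
    Summable.of_norm_bounded ((summable_geometric_of_lt_one hw0 hw1).mul_left C) fun i => by
      rw [norm_mul, norm_pow, Real.norm_of_nonneg hw0]
      exact mul_le_mul_of_nonneg_right (hC i) (pow_nonneg hw0 i)
  -- The coefficient recurrence is equivalent to a `q`-difference equation; iterating it moves the
  -- argument to `0`, where the series equals `1`.
  have hfe : ∀ w : ℝ, 0 ≤ w → w < 1 →
      (1 - w) * ∑' i, c i * w ^ i = (1 - a * w) * ∑' i, c i * (p * w) ^ i := by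
    intro w hw0 hw1
    have hpw0 : 0 ≤ p * w := by positivity
    have hpw1 : p * w < 1 := by nlinarith
    have s1 := hsum w hw0 hw1
    have s2 := hsum _ hpw0 hpw1
    have s1' : Summable fun i => c (i + 1) * w ^ (i + 1) := (summable_nat_add_iff 1).2 s1
    have s2' : Summable fun i => c (i + 1) * (p * w) ^ (i + 1) := (summable_nat_add_iff 1).2 s2
    have e1 := s1.tsum_eq_zero_add
    have e2 := s2.tsum_eq_zero_add
    have key : ∑' i, c (i + 1) * w ^ (i + 1) - ∑' i, c (i + 1) * (p * w) ^ (i + 1)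
        = w * ∑' i, c i * w ^ i - a * w * ∑' i, c i * (p * w) ^ i := by
      rw [← s1'.tsum_sub s2', ← tsum_mul_left, ← tsum_mul_left,
        ← (s1.mul_left w).tsum_sub (s2.mul_left (a * w))]
      refine tsum_congr fun i => ?_
      have := hcrec i
      rw [mul_pow, mul_pow]
      linear_combination w ^ (i + 1) * this
    simp only [pow_zero, mul_one] at e1 e2
    linear_combination key + e1 - e2
  have hiter : ∀ n : ℕ, qPoch z p n * ∑' i, c i * z ^ i
      = qPoch (a * z) p n * ∑' i, c i * (p ^ n * z) ^ i := by
    intro n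
    induction n with
    | zero => simp [qPoch_zero]
    | succ n ih =>
      have hw0 : 0 ≤ p ^ n * z := by positivity
      have hw1 : p ^ n * z < 1 :=
        lt_of_le_of_lt (mul_le_of_le_one_left hz0 (pow_le_one₀ hp0.le hp1.le)) hz1
      have h := hfe _ hw0 hw1
      rw [qPoch_succ, qPoch_succ, pow_succ', mul_assoc p]
      linear_combination (1 - z * p ^ n) * ih + qPoch (a * z) p n * h
  have hlim : Tendsto (fun n : ℕ => ∑' i, c i * (p ^ n * z) ^ i) atTop (𝓝 1) := by
    have h1 : (∑' i, c i * (0 : ℝ) ^ i) = 1 := by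
      rw [tsum_eq_single 0 (fun i hi => by simp [hi])]
      simp [hc, qPoch_zero]
    rw [← h1]
    refine tendsto_tsum_of_dominated_convergence
      ((summable_geometric_of_lt_one hz0 hz1).mul_left C) (fun i => ?_) (Eventually.of_forall
        fun n i => ?_)
    · have : Tendsto (fun n : ℕ => p ^ n * z) atTop (𝓝 0) := by
        simpa using (tendsto_pow_atTop_nhds_zero_of_lt_one hp0.le hp1).mul_const z
      exact (this.pow i).const_mul (c i)
    · have hw0 : 0 ≤ p ^ n * z := by positivity
      rw [norm_mul, norm_pow, Real.norm_of_nonneg hw0]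
      exact mul_le_mul (hC i) (pow_le_pow_left₀ hw0
        (mul_le_of_le_one_left hz0 (pow_le_one₀ hp0.le hp1.le)) i) (by positivity) hC0
  have := tendsto_nhds_unique
    (((tendsto_qPoch hp0.le hp1 z).mul_const (∑' i, c i * z ^ i)).congr hiter)
    ((tendsto_qPoch hp0.le hp1 (a * z)).mul hlim)
  rw [eq_div_iff (qPochInf_ne_zero hp0.le hp1 hz0 hz1)]
  linear_combination this

end InfiniteProducts

/-! ### Convergence of theta-type majorants. -/

section Gaussian

variable {q : ℝ}

lemma summable_pow_sq_mul_pow (hq0 : 0 < q) (hq1 : q < 1) {A : ℝ} (hA : 0 < A) :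
    Summable fun n : ℕ => q ^ (n * n) * A ^ n := by
  refine summable_of_ratio_test_tendsto_lt_one (l := 0) one_pos
    (Eventually.of_forall fun n => by positivity) ?_
  have h : Tendsto (fun n : ℕ => q * A * (q ^ 2) ^ n) atTop (𝓝 0) := by
    simpa using (tendsto_pow_atTop_nhds_zero_of_lt_one (r := q ^ 2) (by positivity)
      (pow_lt_one₀ hq0.le hq1 two_ne_zero)).const_mul (q * A)
  refine h.congr fun n => ?_
  have e : q ^ ((n + 1) * (n + 1)) = q ^ (n * n) * q * (q ^ 2) ^ n := by ring
  rw [Real.norm_of_nonneg (by positivity), Real.norm_of_nonneg (by positivity), e, pow_succ A]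
  field_simp

lemma summable_zpow_sq_mul_zpow (hq0 : 0 < q) (hq1 : q < 1) {A : ℝ} (hA : 0 < A) :
    Summable fun n : ℤ => q ^ (n * n) * A ^ n := by
  refine Summable.of_nat_of_neg ?_ ?_
  · refine (summable_pow_sq_mul_pow hq0 hq1 hA).congr fun n => ?_
    rw [← Nat.cast_mul, zpow_natCast, zpow_natCast]
  · refine (summable_pow_sq_mul_pow hq0 hq1 (inv_pos.2 hA)).congr fun n => ?_
    rw [neg_mul_neg, ← Nat.cast_mul, zpow_natCast, zpow_neg, zpow_natCast, inv_pow]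

lemma summable_zpow_mul_succ (hq0 : 0 < q) (hq1 : q < 1) {A : ℝ} (hA : 0 < A) :
    Summable fun n : ℤ => q ^ (n * (n + 1)) * A ^ n := by
  refine (summable_zpow_sq_mul_zpow hq0 hq1 (mul_pos hq0 hA)).congr fun n => ?_
  rw [mul_zpow, mul_add, mul_one, zpow_add₀ hq0.ne']
  ring

lemma summable_pow_mul_succ (hq0 : 0 < q) (hq1 : q < 1) {A : ℝ} (hA : 0 < A) :
    Summable fun n : ℕ => q ^ (n * (n + 1)) * A ^ n := by
  refine (summable_pow_sq_mul_pow hq0 hq1 (mul_pos hq0 hA)).congr fun n => ?_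
  rw [mul_pow]
  ring

end Gaussian

/-! ### Reciprocal factorials on all integers. -/

section ReciprocalFactorial

variable {p : ℝ}

/-- The reciprocal `1 / (p; p)_n` of the `q`-factorial, extended by `0` to negative integers. -/
noncomputable def qFacInv (p : ℝ) (n : ℤ) : ℝ := qPochInf (p ^ (n + 1)) p / qPochInf p p

lemma qFacInv_natCast (hp0 : 0 < p) (hp1 : p < 1) (n : ℕ) :
    qFacInv p n = (qPoch p p n)⁻¹ := by
  have h := qPochInf_eq_qPoch_mul hp0.le hp1 p n
  have h1 := qPochInf_ne_zero hp0.le hp1 hp0.le hp1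
  have h2 := qPoch_ne_zero hp0.le hp1 hp0.le hp1 n
  have e : p ^ ((n : ℤ) + 1) = p * p ^ n := by
    rw [zpow_add_one₀ hp0.ne', zpow_natCast, mul_comm]
  rw [qFacInv, e, div_eq_iff h1, h, inv_mul_cancel_left₀ h2]

lemma qFacInv_of_neg (hp0 : 0 < p) (hp1 : p < 1) {n : ℤ} (hn : n < 0) : qFacInv p n = 0 := by
  obtain ⟨j, hj⟩ := Int.eq_ofNat_of_zero_le (show 0 ≤ -(n + 1) by omega)
  have e : p ^ (n + 1) * p ^ j = 1 := by
    rw [← zpow_natCast, ← zpow_add₀ hp0.ne', ← hj]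
    simp
  -- The factor of index `j = -(n+1)` is `1 - 1`; splitting off `j + 1` factors exposes it.
  rw [qFacInv, qPochInf_eq_qPoch_mul hp0.le hp1 _ (j + 1), qPoch_succ, e]
  simp

lemma qFacInv_zero (hp0 : 0 < p) (hp1 : p < 1) : qFacInv p 0 = 1 := by
  simpa [qPoch_zero] using qFacInv_natCast hp0 hp1 0

/-- No exception occurs at `n ≤ 0`, where both sides vanish, so later recurrences need no boundary
cases. -/
lemma qFacInv_mul_one_sub (hp0 : 0 < p) (hp1 : p < 1) (n : ℤ) :
    qFacInv p n * (1 - p ^ n) = qFacInv p (n - 1) := by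
  rw [qFacInv, qFacInv, sub_add_cancel, qPochInf_eq_mul hp0.le hp1 (p ^ n),
    zpow_add_one₀ hp0.ne']
  ring

lemma exists_abs_qFacInv_le (hp0 : 0 < p) (hp1 : p < 1) :
    ∃ C, 0 ≤ C ∧ ∀ n, |qFacInv p n| ≤ C := by
  -- For `a = 0` the numerator is `1`, so this bounds `1/(p;p)_n`.
  obtain ⟨C, hC0, hC⟩ := exists_abs_qPoch_div_le hp0.le hp1 0
  refine ⟨C, hC0, fun n => ?_⟩
  rcases lt_or_ge n 0 with hn | hn
  · simpa [qFacInv_of_neg hp0 hp1 hn]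
  · lift n to ℕ using hn
    simpa [qFacInv_natCast hp0 hp1, qPoch] using hC n

end ReciprocalFactorial

lemma tsum_int_eq_tsum_nat {f : ℤ → ℝ} (hf : ∀ n < 0, f n = 0) :
    ∑' n : ℤ, f n = ∑' n : ℕ, f n := by
  refine (Function.Injective.tsum_eq Nat.cast_injective fun n hn => ?_).symm
  have : 0 ≤ n := by
    by_contra h
    exact hn (hf n (not_le.1 h))
  exact ⟨n.toNat, Int.toNat_of_nonneg this⟩

/-! ### Euler's expansion and the symmetry it implies. -/

section Euler

variable {q : ℝ}

/-- The coefficients of Euler's expansion of `(q² w; q²)_∞`. -/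
noncomputable def eulerCoeff (q : ℝ) (s : ℕ) : ℝ := (-1) ^ s * q ^ (s * (s + 1)) / qPoch (q ^ 2) (q ^ 2) s

lemma exists_abs_eulerCoeff_le (hq0 : 0 < q) (hq1 : q < 1) :
    ∃ C, 0 ≤ C ∧ ∀ s, |eulerCoeff q s| ≤ C * q ^ (s * (s + 1)) := by
  obtain ⟨C, hC0, hC⟩ := exists_abs_qPoch_div_le (sq_nonneg q)
    (pow_lt_one₀ hq0.le hq1 two_ne_zero) 0
  refine ⟨C, hC0, fun s => ?_⟩
  have h : |(qPoch (q ^ 2) (q ^ 2) s)⁻¹| ≤ C := by simpa [qPoch] using hC s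
  rw [eulerCoeff, div_eq_mul_inv, abs_mul, abs_mul, abs_pow, abs_neg, abs_one, one_pow, one_mul,
    abs_of_nonneg (by positivity), mul_comm C]
  exact mul_le_mul_of_nonneg_left h (by positivity)

lemma eulerCoeff_succ (hq0 : 0 < q) (hq1 : q < 1) (s : ℕ) :
    eulerCoeff q (s + 1) * (1 - (q ^ 2) ^ (s + 1)) = -(q ^ 2 * (q ^ 2) ^ s * eulerCoeff q s) := by
  have hp1 : q ^ 2 < 1 := pow_lt_one₀ hq0.le hq1 two_ne_zero
  have h1 := qPoch_ne_zero (sq_nonneg q) hp1 (sq_nonneg q) hp1 s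
  have h2 := qPoch_ne_zero (sq_nonneg q) hp1 (sq_nonneg q) hp1 (s + 1)
  rw [qPoch_succ] at h2
  have h3 := right_ne_zero_of_mul h2
  rw [eulerCoeff, eulerCoeff, qPoch_succ, pow_succ' (q ^ 2) s]
  generalize hP : 1 - q ^ 2 * (q ^ 2) ^ s = P at *
  rw [div_mul_eq_mul_div, mul_div_mul_right _ _ h3]
  field_simp
  ring_nf

lemma summable_eulerCoeff_mul_pow (hq0 : 0 < q) (hq1 : q < 1) {w : ℝ} (hw : 0 < w) :
    Summable fun s => eulerCoeff q s * w ^ s := by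
  obtain ⟨C, hC0, hC⟩ := exists_abs_eulerCoeff_le hq0 hq1
  refine Summable.of_norm_bounded ((summable_pow_mul_succ hq0 hq1 hw).mul_left C) fun s => ?_
  rw [norm_mul, norm_pow, Real.norm_of_nonneg hw.le, ← mul_assoc]
  exact mul_le_mul_of_nonneg_right (hC s) (by positivity)

/-- Euler's expansion of the infinite `q`-shifted factorial. -/
lemma tsum_eulerCoeff_mul_pow (hq0 : 0 < q) (hq1 : q < 1) {w : ℝ} (hw : 0 < w) :
    ∑' s, eulerCoeff q s * w ^ s = qPochInf (q ^ 2 * w) (q ^ 2) := by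
  have hp0 : 0 < q ^ 2 := by positivity
  have hp1 : q ^ 2 < 1 := pow_lt_one₀ hq0.le hq1 two_ne_zero
  obtain ⟨C, hC0, hC⟩ := exists_abs_eulerCoeff_le hq0 hq1
  have hfe : ∀ w : ℝ, 0 < w → ∑' s, eulerCoeff q s * w ^ s
      = (1 - q ^ 2 * w) * ∑' s, eulerCoeff q s * (q ^ 2 * w) ^ s := by
    intro w hw
    have s1 := summable_eulerCoeff_mul_pow hq0 hq1 hw
    have s2 := summable_eulerCoeff_mul_pow hq0 hq1 (mul_pos hp0 hw)
    have s1' := (summable_nat_add_iff 1).2 s1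
    have s2' := (summable_nat_add_iff 1).2 s2
    have e1 := s1.tsum_eq_zero_add
    have e2 := s2.tsum_eq_zero_add
    have key : ∑' s, eulerCoeff q (s + 1) * w ^ (s + 1)
        - ∑' s, eulerCoeff q (s + 1) * (q ^ 2 * w) ^ (s + 1)
        = -(q ^ 2 * w) * ∑' s, eulerCoeff q s * (q ^ 2 * w) ^ s := by
      rw [← s1'.tsum_sub s2', ← tsum_mul_left]
      refine tsum_congr fun s => ?_
      have := eulerCoeff_succ hq0 hq1 s
      rw [mul_pow, mul_pow]
      linear_combination w ^ (s + 1) * this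
    simp only [pow_zero, mul_one] at e1 e2
    linear_combination key + e1 - e2
  have hiter : ∀ n : ℕ, ∑' s, eulerCoeff q s * w ^ s
      = qPoch (q ^ 2 * w) (q ^ 2) n * ∑' s, eulerCoeff q s * ((q ^ 2) ^ n * w) ^ s := by
    intro n
    induction n with
    | zero => simp [qPoch_zero]
    | succ n ih =>
      rw [ih, hfe _ (by positivity), qPoch_succ, pow_succ' (q ^ 2) n, mul_assoc (q ^ 2)]
      ring_nf
  have hlim : Tendsto (fun n : ℕ => ∑' s, eulerCoeff q s * ((q ^ 2) ^ n * w) ^ s)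
      atTop (𝓝 1) := by
    have h1 : (∑' s, eulerCoeff q s * (0 : ℝ) ^ s) = 1 := by
      rw [tsum_eq_single 0 (fun i hi => by simp [hi])]
      simp [eulerCoeff, qPoch_zero]
    rw [← h1]
    refine tendsto_tsum_of_dominated_convergence
      ((summable_pow_mul_succ hq0 hq1 hw).mul_left C) (fun i => ?_) (Eventually.of_forall
        fun n i => ?_)
    · have : Tendsto (fun n : ℕ => (q ^ 2) ^ n * w) atTop (𝓝 0) := by
        simpa using (tendsto_pow_atTop_nhds_zero_of_lt_one hp0.le hp1).mul_const w
      exact (this.pow i).const_mul _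
    · have hw0 : 0 ≤ (q ^ 2) ^ n * w := by positivity
      rw [norm_mul, norm_pow, Real.norm_of_nonneg hw0, ← mul_assoc]
      exact mul_le_mul (hC i) (pow_le_pow_left₀ (by positivity)
        (mul_le_of_le_one_left hw.le (pow_le_one₀ hp0.le hp1.le)) i) (by positivity)
        (by positivity)
  have h := (tendsto_qPoch hp0.le hp1 (q ^ 2 * w)).mul hlim
  rw [mul_one] at h
  exact tendsto_nhds_unique tendsto_const_nhds (h.congr fun n => (hiter n).symm)

/-- The symmetry of `(w; p)_∞ ₁φ₁(0; w; p, z)` in `w` and `z`. -/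
lemma tsum_eulerCoeff_mul_qPochInf_comm (hq0 : 0 < q) (hq1 : q < 1) {a b : ℝ} (ha : 0 < a)
    (hb : 0 < b) :
    ∑' s, eulerCoeff q s * a ^ s * qPochInf (q ^ 2 * (b * (q ^ 2) ^ s)) (q ^ 2)
      = ∑' s, eulerCoeff q s * b ^ s * qPochInf (q ^ 2 * (a * (q ^ 2) ^ s)) (q ^ 2) := by
  -- Expanding the infinite product gives a double series whose only coupling `(q²)^{su}` is
  -- symmetric in `s` and `u`.
  have key : ∀ a b : ℝ, 0 < a → 0 < b →
      ∑' s, eulerCoeff q s * a ^ s * qPochInf (q ^ 2 * (b * (q ^ 2) ^ s)) (q ^ 2)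
        = ∑' s, ∑' u, eulerCoeff q s * a ^ s * (eulerCoeff q u * b ^ u) * (q ^ 2) ^ (s * u) := by
    intro a b ha hb
    refine tsum_congr fun s => ?_
    rw [← tsum_eulerCoeff_mul_pow hq0 hq1 (by positivity), ← tsum_mul_left]
    refine tsum_congr fun u => ?_
    rw [mul_pow, ← pow_mul]
    ring
  rw [key a b ha hb, key b a hb ha, Summable.tsum_comm]
  · refine tsum_congr fun s => tsum_congr fun u => ?_
    rw [mul_comm u s]
    ring
  · refine Summable.of_norm_bounded ((summable_eulerCoeff_mul_pow hq0 hq1 hb).norm.mul_norm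
      (summable_eulerCoeff_mul_pow hq0 hq1 ha).norm) fun x => ?_
    rw [Function.uncurry, norm_mul _ ((q ^ 2) ^ (x.2 * x.1)), mul_comm (eulerCoeff q x.2 * _)]
    refine mul_le_of_le_one_right (norm_nonneg _) ?_
    rw [Real.norm_of_nonneg (by positivity)]
    exact pow_le_one₀ (by positivity) (pow_le_one₀ hq0.le hq1.le)

end Euler

/-! ### Bessel functions of integer order: symmetry and growth in the order. -/

section IntegerOrder

variable {q x : ℝ}

/-- The terms of the series of the Hahn-Exton `q`-Bessel function of integer order. -/
noncomputable def besselTerm (q x : ℝ) (n b : ℤ) : ℝ :=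
  (-1) ^ b * q ^ (b * (b + 1)) * x ^ (n + 2 * b) * qFacInv (q ^ 2) b * qFacInv (q ^ 2) (n + b)

/-- The Hahn-Exton `q`-Bessel function `J_n(x, q²)` of integer order `n`. -/
noncomputable def besselInt (q x : ℝ) (n : ℤ) : ℝ := ∑' b, besselTerm q x n b

lemma sq_zpow (q : ℝ) (n : ℤ) : (q ^ 2) ^ n = q ^ (2 * n) := by
  rw [zpow_mul]; norm_cast

lemma abs_neg_one_zpow (b : ℤ) : |(-1 : ℝ) ^ b| = 1 := by
  rw [abs_zpow]; simp

/-- Symmetry of the Hahn-Exton function between its order and the exponent of its argument. -/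
lemma hahnExtonJ_zpow (hq0 : 0 < q) (hq1 : q < 1) (α : ℝ) (β : ℤ) :
    hahnExtonJ α (q ^ β) (q ^ 2) = besselInt q (q ^ α) β := by
  have hp0 : 0 < q ^ 2 := by positivity
  have hp1 : q ^ 2 < 1 := pow_lt_one₀ hq0.le hq1 two_ne_zero
  have hx : 0 < q ^ α := Real.rpow_pos_of_pos hq0 α
  rw [hahnExtonJ, besselInt, tsum_int_eq_tsum_nat fun n hn => by
    simp [besselTerm, qFacInv_of_neg hp0 hp1 hn]]
  have e1 : ∀ r : ℕ, (-1) ^ r * ((q ^ 2) ^ (r * (r + 1) / 2)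
      * qPochInf ((q ^ 2) ^ (α + 1 + (r : ℝ))) (q ^ 2) / qPoch (q ^ 2) (q ^ 2) r)
      * (q ^ β) ^ (2 * r) = eulerCoeff q r * ((q ^ β) ^ 2) ^ r
        * qPochInf (q ^ 2 * ((q ^ α) ^ 2 * (q ^ 2) ^ r)) (q ^ 2) := by
    intro r
    have h1 : (q ^ 2) ^ (α + 1 + (r : ℝ)) = q ^ 2 * ((q ^ α) ^ 2 * (q ^ 2) ^ r) := by
      rw [Real.rpow_add hp0, Real.rpow_add hp0, Real.rpow_one, Real.rpow_natCast,
        ← Real.rpow_natCast q 2, ← Real.rpow_natCast (q ^ α) 2, ← Real.rpow_mul hq0.le,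
        ← Real.rpow_mul hq0.le, mul_comm α]
      ring
    have h2 : (q ^ 2) ^ (r * (r + 1) / 2) = q ^ (r * (r + 1)) := by
      rw [← pow_mul, Nat.mul_div_cancel' (Nat.even_mul_succ_self r).two_dvd]
    rw [h1, h2, eulerCoeff, pow_mul]
    ring
  -- The same series as in `e1` with `(q^α)²` and `(q^β)²` exchanged; the prefactors agree by `e3`.
  have e2 : ∀ b : ℕ, besselTerm q (q ^ α) β b = (q ^ α) ^ β / qPochInf (q ^ 2) (q ^ 2) *
      (eulerCoeff q b * ((q ^ α) ^ 2) ^ b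
        * qPochInf (q ^ 2 * ((q ^ β) ^ 2 * (q ^ 2) ^ b)) (q ^ 2)) := by
    intro b
    have h1 : (q ^ 2) ^ (β + (b : ℤ) + 1) = q ^ 2 * ((q ^ β) ^ 2 * (q ^ 2) ^ b) := by
      rw [zpow_add₀ hp0.ne', zpow_add₀ hp0.ne', zpow_one, zpow_natCast, sq_zpow, mul_comm 2 β,
        zpow_mul]
      norm_cast
      ring
    have h2 : (q ^ α) ^ (β + 2 * (b : ℤ)) = (q ^ α) ^ β * ((q ^ α) ^ 2) ^ b := by
      rw [zpow_add₀ hx.ne', zpow_mul]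
      norm_cast
    have h3 : q ^ ((b : ℤ) * ((b : ℤ) + 1)) = q ^ (b * (b + 1)) := by
      rw [← zpow_natCast]; norm_cast
    rw [besselTerm, qFacInv_natCast hp0 hp1, qFacInv, h1, h2, h3, eulerCoeff, zpow_natCast]
    ring
  have e3 : (q ^ β) ^ α = (q ^ α) ^ β := by
    rw [← Real.rpow_intCast, ← Real.rpow_intCast, ← Real.rpow_mul hq0.le,
      ← Real.rpow_mul hq0.le, mul_comm]
  rw [tsum_congr e1, tsum_congr e2, tsum_mul_left, e3, tsum_eulerCoeff_mul_qPochInf_comm hq0 hq1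
    (by positivity) (by positivity)]

lemma abs_besselTerm (hq0 : 0 < q) (hx : 0 < x) (n b : ℤ) :
    |besselTerm q x n b| = q ^ (b * (b + 1)) * x ^ (n + 2 * b) * |qFacInv (q ^ 2) b|
      * |qFacInv (q ^ 2) (n + b)| := by
  rw [besselTerm, abs_mul, abs_mul, abs_mul, abs_mul, abs_neg_one_zpow, one_mul,
    abs_of_pos (zpow_pos hq0 _), abs_of_pos (zpow_pos hx _)]

lemma summable_zpow_mul_succ_sq (hq0 : 0 < q) (hq1 : q < 1) (hx : 0 < x) :
    Summable fun b : ℤ => q ^ (b * (b + 1)) * x ^ (2 * b) := by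
  simpa only [zpow_mul, zpow_ofNat] using
    summable_zpow_mul_succ hq0 hq1 (A := x ^ 2) (by positivity)

lemma exists_abs_besselTerm_le (hq0 : 0 < q) (hq1 : q < 1) :
    ∃ C, 0 ≤ C ∧ ∀ x, 0 < x → ∀ n b,
      |besselTerm q x n b| ≤ C * x ^ n * (q ^ (b * (b + 1)) * x ^ (2 * b)) := by
  obtain ⟨C, hC0, hC⟩ := exists_abs_qFacInv_le (p := q ^ 2) (by positivity)
    (pow_lt_one₀ hq0.le hq1 two_ne_zero)
  refine ⟨C * C, mul_nonneg hC0 hC0, fun x hx n b => ?_⟩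
  rw [abs_besselTerm hq0 hx, zpow_add₀ hx.ne', mul_assoc]
  have h1 : 0 < q ^ (b * (b + 1)) := zpow_pos hq0 _
  have h2 : 0 < x ^ n := zpow_pos hx _
  have h3 : 0 < x ^ (2 * b) := zpow_pos hx _
  calc _ ≤ q ^ (b * (b + 1)) * (x ^ n * x ^ (2 * b)) * (C * C) :=
        mul_le_mul_of_nonneg_left (mul_le_mul (hC _) (hC _) (abs_nonneg _) hC0) (by positivity)
    _ = _ := by ring

lemma summable_besselTerm (hq0 : 0 < q) (hq1 : q < 1) (hx : 0 < x) (n : ℤ) :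
    Summable (besselTerm q x n) := by
  obtain ⟨C, hC0, hC⟩ := exists_abs_besselTerm_le hq0 hq1
  exact Summable.of_norm_bounded ((summable_zpow_mul_succ_sq hq0 hq1 hx).mul_left _)
    fun b => hC x hx n b

/-- Pulling out `x^n` leaves a theta-type majorant independent of `n`. This is the bound used as `n
→ +∞`. -/
lemma exists_abs_besselInt_le (hq0 : 0 < q) (hq1 : q < 1) (hx : 0 < x) :
    ∃ C, 0 ≤ C ∧ ∀ n, |besselInt q x n| ≤ C * x ^ n := by
  obtain ⟨C, hC0, hC⟩ := exists_abs_besselTerm_le hq0 hq1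
  have hs := summable_zpow_mul_succ_sq hq0 hq1 hx
  refine ⟨C * ∑' b : ℤ, q ^ (b * (b + 1)) * x ^ (2 * b),
    mul_nonneg hC0 (tsum_nonneg fun b => (mul_pos (zpow_pos hq0 _) (zpow_pos hx _)).le),
    fun n => ?_⟩
  have := tsum_of_norm_bounded (f := besselTerm q x n) (hs.mul_left (C * x ^ n)).hasSum fun b => hC x hx n b
  rw [tsum_mul_left] at this
  calc _ ≤ _ := this
    _ = _ := by ring

/-- Nonzero terms need `n + b ≥ 0`, so for very negative `n` the series starts at `b = -n`, deep in
the Gaussian factor. With `a = n + b`, the exponent `b(b+1)` splits as `a(a+1) + n(n-1) - 2na`. -/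
lemma exists_abs_besselInt_le_of_le (hq0 : 0 < q) (hq1 : q < 1) (hx : 0 < x) (M : ℤ) :
    ∃ C, 0 ≤ C ∧ ∀ n ≤ M, |besselInt q x n| ≤ C * (q ^ (n * (n - 1)) * x ^ (-n)) := by
  have hp0 : 0 < q ^ 2 := by positivity
  have hp1 : q ^ 2 < 1 := pow_lt_one₀ hq0.le hq1 two_ne_zero
  obtain ⟨C, hC0, hC⟩ := exists_abs_qFacInv_le hp0 hp1
  -- For `a ≥ 0` and `n ≤ M` the cross term `q^{-2na}` is at most `q^{-2Ma}`, which this base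
  -- absorbs.
  have hA : 0 < x ^ 2 * q ^ (-2 * M) := mul_pos (by positivity) (zpow_pos hq0 _)
  have hs := summable_zpow_mul_succ hq0 hq1 hA
  refine ⟨C * C * ∑' a : ℤ, q ^ (a * (a + 1)) * (x ^ 2 * q ^ (-2 * M)) ^ a,
    mul_nonneg (mul_nonneg hC0 hC0)
      (tsum_nonneg fun b => (mul_pos (zpow_pos hq0 _) (zpow_pos hA _)).le), fun n hn => ?_⟩
  have hbd : ∀ a : ℤ, |besselTerm q x n (a - n)| ≤ C * C * (q ^ (n * (n - 1)) * x ^ (-n)) *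
      (q ^ (a * (a + 1)) * (x ^ 2 * q ^ (-2 * M)) ^ a) := by
    intro a
    have h1 : 0 < q ^ (a * (a + 1)) := zpow_pos hq0 _
    have h2 : 0 < q ^ (n * (n - 1)) := zpow_pos hq0 _
    have h3 : 0 < x ^ (-n) := zpow_pos hx _
    have h4 : 0 < (x ^ 2 * q ^ (-2 * M)) ^ a := zpow_pos hA _
    rcases lt_or_ge a 0 with ha | ha
    · have : besselTerm q x n (a - n) = 0 := by
        rw [besselTerm, add_sub_cancel, qFacInv_of_neg hp0 hp1 ha, mul_zero]
      rw [this, abs_zero]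
      positivity
    · rw [abs_besselTerm hq0 hx, mul_assoc (q ^ _ * _)]
      have e1 : q ^ ((a - n) * (a - n + 1))
          = q ^ (a * (a + 1)) * q ^ (n * (n - 1)) * q ^ (-2 * n * a) := by
        rw [← zpow_add₀ hq0.ne', ← zpow_add₀ hq0.ne']; congr 1; ring
      have e2 : x ^ (n + 2 * (a - n)) = x ^ (-n) * (x ^ 2) ^ a := by
        rw [sq_zpow, ← zpow_add₀ hx.ne']; congr 1; ring
      have e3 : q ^ (-2 * n * a) ≤ (q ^ (-2 * M)) ^ a := by
        rw [← zpow_mul]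
        exact zpow_le_zpow_right_of_le_one₀ hq0 hq1.le (by nlinarith)
      rw [e1, e2, mul_zpow]
      have h5 : 0 < (x ^ 2) ^ a := zpow_pos (by positivity) _
      calc _ ≤ q ^ (a * (a + 1)) * q ^ (n * (n - 1)) * (q ^ (-2 * M)) ^ a
            * (x ^ (-n) * (x ^ 2) ^ a) * (C * C) :=
          mul_le_mul (mul_le_mul_of_nonneg_right (mul_le_mul_of_nonneg_left e3 (by positivity))
            (by positivity)) (mul_le_mul (hC _) (hC _) (abs_nonneg _) hC0) (by positivity)
            (mul_nonneg (mul_nonneg (by positivity) (zpow_nonneg (zpow_pos hq0 _).le _) |>.trans_eq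
              rfl) (by positivity))
        _ = _ := by ring
  have := tsum_of_norm_bounded (f := fun a => besselTerm q x n (a - n))
    (hs.mul_left (C * C * (q ^ (n * (n - 1)) * x ^ (-n)))).hasSum hbd
  rw [tsum_mul_left] at this
  calc |besselInt q x n| = |∑' a : ℤ, besselTerm q x n (a - n)| := by
        rw [besselInt, ← (Equiv.subRight n).tsum_eq]; rfl
    _ ≤ _ := this
    _ = _ := by ring

lemma summable_zpow_mul_besselInt (hq0 : 0 < q) (hq1 : q < 1) (hx : 0 < x) {ρ : ℝ} (hρ : 0 < ρ)
    (hρx : ρ * x < 1) : Summable fun n : ℤ => ρ ^ n * besselInt q x n := by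
  refine Summable.of_nat_of_neg ?_ ?_
  · obtain ⟨C, hC0, hC⟩ := exists_abs_besselInt_le hq0 hq1 hx
    refine Summable.of_norm_bounded
      ((summable_geometric_of_lt_one (by positivity) hρx).mul_left C) fun n => ?_
    rw [norm_mul, Real.norm_of_nonneg (zpow_pos hρ _).le]
    calc _ ≤ ρ ^ (n : ℤ) * (C * x ^ (n : ℤ)) :=
          mul_le_mul_of_nonneg_left (hC n) (zpow_pos hρ _).le
      _ = _ := by rw [zpow_natCast, zpow_natCast]; ring
  · obtain ⟨C, hC0, hC⟩ := exists_abs_besselInt_le_of_le hq0 hq1 hx 0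
    have hs := summable_pow_mul_succ hq0 hq1 (A := ρ⁻¹ * x) (by positivity)
    refine Summable.of_norm_bounded (hs.mul_left C) fun n => ?_
    rw [norm_mul, Real.norm_of_nonneg (zpow_pos hρ _).le]
    calc _ ≤ ρ ^ (-(n : ℤ)) * (C * (q ^ (-(n : ℤ) * (-(n : ℤ) - 1)) * x ^ (- -(n : ℤ)))) :=
          mul_le_mul_of_nonneg_left (hC _ (by simp)) (zpow_pos hρ _).le
      _ = _ := by
        have : -(n : ℤ) * (-(n : ℤ) - 1) = ((n * (n + 1) : ℕ) : ℤ) := by push_cast; ring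
        rw [this, neg_neg, zpow_natCast, zpow_natCast, zpow_neg, zpow_natCast, mul_pow, inv_pow]
        ring

end IntegerOrder

/-! ### Regrouping a product of four Laurent series. -/

section Convolution

/-- With `Fᵢ(t) = ∑ fᵢ(n) tⁿ`, both sides are the coefficient of `t^m` in `F₁(t) F₂(1/t) F₃(1/t)
F₄(t)`, grouped as `(F₁F₂)(F₃F₄)` and as `(F₂F₃)(F₁F₄)`. -/
lemma tsum_mul_tsum_conv {f₁ f₂ f₃ f₄ : ℤ → ℝ} (h₁ : Summable f₁) (h₂ : Summable f₂)
    (h₃ : Summable f₃) (h₄ : Summable f₄) (m : ℤ) :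
    ∑' r, (∑' b, f₁ (m + r + b) * f₂ b) * (∑' d, f₃ (r + d) * f₄ d)
      = ∑' n, (∑' b, f₃ (n - b) * f₂ b) * (∑' d, f₁ (m + n - d) * f₄ d) := by
  have bdd : ∀ {f : ℤ → ℝ}, Summable f → ∃ C, ∀ n, |f n| ≤ C := fun {f} hf =>
    ⟨∑' n, ‖f n‖, fun n => hf.norm.le_tsum n fun _ _ => norm_nonneg _⟩
  have hprod : ∀ {f g : ℤ → ℝ} (e : ℤ → ℤ), Summable f → Summable g →
      Summable fun b => f (e b) * g b := by
    intro f g e hf hg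
    obtain ⟨C, hC⟩ := bdd hf
    refine Summable.of_norm_bounded (hg.norm.mul_left C) fun b => ?_
    rw [norm_mul]
    exact mul_le_mul_of_nonneg_right (hC _) (norm_nonneg _)
  -- The coordinates are the arguments of `f₃`, `f₂`, `f₄`; the shears `e₁` and `e₂` below yield the
  -- two groupings.
  let H : ℤ × (ℤ × ℤ) → ℝ := fun z =>
    f₁ (m + z.1 + z.2.1 - z.2.2) * (f₃ z.1 * (f₂ z.2.1 * f₄ z.2.2))
  have hH : Summable H := by
    obtain ⟨C, hC⟩ := bdd h₁
    refine Summable.of_norm_bounded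
      ((h₃.norm.mul_norm (h₂.norm.mul_norm h₄.norm)).mul_left C) fun z => ?_
    rw [norm_mul]
    exact mul_le_mul_of_nonneg_right (hC _) (norm_nonneg _)
  let e₁ : ℤ × (ℤ × ℤ) ≃ ℤ × (ℤ × ℤ) :=
    ⟨fun z => (z.1 + z.2.2, z.2), fun z => (z.1 - z.2.2, z.2), fun z => by simp, fun z => by simp⟩
  let e₂ : ℤ × (ℤ × ℤ) ≃ ℤ × (ℤ × ℤ) :=
    ⟨fun z => (z.1 - z.2.1, z.2), fun z => (z.1 + z.2.1, z.2), fun z => by simp, fun z => by simp⟩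
  have hL : ∑' z, H (e₁ z)
      = ∑' r, (∑' b, f₁ (m + r + b) * f₂ b) * (∑' d, f₃ (r + d) * f₄ d) := by
    rw [Summable.tsum_prod (f := fun z => H (e₁ z)) (e₁.summable_iff.2 hH)]
    refine tsum_congr fun r => ?_
    rw [tsum_mul_tsum_of_summable_norm (hprod _ h₁ h₂).norm (hprod _ h₃ h₄).norm]
    refine tsum_congr fun z => ?_
    have : m + (r + z.2) + z.1 - z.2 = m + r + z.1 := by ring
    simp only [H, e₁, Equiv.coe_fn_mk, this]
    ring
  have hR : ∑' z, H (e₂ z)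
      = ∑' n, (∑' b, f₃ (n - b) * f₂ b) * (∑' d, f₁ (m + n - d) * f₄ d) := by
    rw [Summable.tsum_prod (f := fun z => H (e₂ z)) (e₂.summable_iff.2 hH)]
    refine tsum_congr fun r => ?_
    rw [tsum_mul_tsum_of_summable_norm (hprod _ h₃ h₂).norm (hprod _ h₁ h₄).norm]
    refine tsum_congr fun z => ?_
    have : m + (r - z.1) + z.1 - z.2 = m + r - z.2 := by ring
    simp only [H, e₂, Equiv.coe_fn_mk, this]
    ring
  rw [← hL, ← hR, e₁.tsum_eq, e₂.tsum_eq]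

end Convolution

/-! ### Closed form of the finite `q`-binomial sums. -/

section Vandermonde

variable {q : ℝ}

/-- The terms of the finite `q`-binomial sum `∑ (-1)^j q^{j(j-1) - 2Bj} / ((q²)_j (q²)_{n-j})`. -/
noncomputable def vdmTerm (q : ℝ) (B n j : ℤ) : ℝ :=
  qFacInv (q ^ 2) (n - j) * qFacInv (q ^ 2) j * ((-1) ^ j * q ^ (j * (j - 1) - 2 * B * j))

lemma summable_vdmTerm (hq0 : 0 < q) (hq1 : q < 1) (B n : ℤ) : Summable (vdmTerm q B n) := by
  have hp0 : 0 < q ^ 2 := by positivity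
  have hp1 : q ^ 2 < 1 := pow_lt_one₀ hq0.le hq1 two_ne_zero
  refine summable_of_ne_finset_zero (s := Finset.Icc 0 n) fun j hj => ?_
  rw [Finset.mem_Icc, not_and_or, not_le, not_le] at hj
  rcases hj with hj | hj
  · simp [vdmTerm, qFacInv_of_neg hp0 hp1 hj]
  · simp [vdmTerm, qFacInv_of_neg hp0 hp1 (sub_neg.2 hj)]

/-- The sums are the coefficients of `G(t) = (q^{-2B}t; q²)_∞ / (t; q²)_∞`, and this is `(1-t) G(t)
= (1 - q^{-2B}t) G(q²t)` read at `t^n`. -/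
lemma tsum_vdmTerm_rec (hq0 : 0 < q) (hq1 : q < 1) (B n : ℤ) :
    (1 - (q ^ 2) ^ n) * ∑' j, vdmTerm q B n j
      = (1 - q ^ (2 * (n - 1) - 2 * B)) * ∑' j, vdmTerm q B (n - 1) j := by
  have hp0 : 0 < q ^ 2 := by positivity
  have hp1 : q ^ 2 < 1 := pow_lt_one₀ hq0.le hq1 two_ne_zero
  have hs := summable_vdmTerm hq0 hq1 B (n - 1)
  -- Split `1 - q^{2n} = (1 - q^{2(n-j)}) + q^{2(n-j)}(1 - q^{2j})`; each part lowers one of the two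
  -- factorials.
  have h1 : ∀ j, (1 - (q ^ 2) ^ n) * vdmTerm q B n j = vdmTerm q B (n - 1) j
      + -q ^ (2 * (n - 1) - 2 * B) * vdmTerm q B (n - 1) (j - 1) := by
    intro j
    have e1 := qFacInv_mul_one_sub hp0 hp1 j
    have e2 := qFacInv_mul_one_sub hp0 hp1 (n - j)
    have e3 : (q ^ 2) ^ n = (q ^ 2) ^ (n - j) * (q ^ 2) ^ j := by
      rw [← zpow_add₀ hp0.ne']; congr 1; ring
    have e4 : (q ^ 2) ^ (n - j) * q ^ (j * (j - 1) - 2 * B * j)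
        = q ^ (2 * (n - 1) - 2 * B) * q ^ ((j - 1) * (j - 1 - 1) - 2 * B * (j - 1)) := by
      rw [sq_zpow, ← zpow_add₀ hq0.ne', ← zpow_add₀ hq0.ne']; congr 1; ring
    have e5 : (-1 : ℝ) ^ j = -(-1) ^ (j - 1) := by
      rw [zpow_sub_one₀ (by norm_num)]; norm_num
    have e6 : n - 1 - (j - 1) = n - j := by ring
    have e7 : n - 1 - j = n - j - 1 := by ring
    simp only [vdmTerm]
    rw [e6, e7, ← e1, ← e2, e3]
    rw [e5]
    linear_combination (-qFacInv (q ^ 2) (n - j) * (qFacInv (q ^ 2) j * (1 - (q ^ 2) ^ j))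
      * (-1) ^ (j - 1)) * e4
  have hs' : Summable fun j => vdmTerm q B (n - 1) (j - 1) :=
    (Equiv.subRight (1 : ℤ)).summable_iff.2 hs
  have he : ∑' j, vdmTerm q B (n - 1) (j - 1) = ∑' j, vdmTerm q B (n - 1) j :=
    (Equiv.subRight (1 : ℤ)).tsum_eq _
  rw [← tsum_mul_left, tsum_congr h1, Summable.tsum_add hs (hs'.mul_left _), tsum_mul_left, he]
  ring

/-- The sum is `(q^{-2B}; q²)_n / (q²; q²)_n`. The extra factor `1/(q²; q²)_B` turns its numerator
into a reciprocal factorial of `B - n`, which encodes the vanishing for `n > B`. -/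
lemma qFacInv_mul_tsum_vdmTerm (hq0 : 0 < q) (hq1 : q < 1) (B n : ℤ) :
    qFacInv (q ^ 2) B * ∑' j, vdmTerm q B n j
      = (-1) ^ n * q ^ (n * (n - 1) - 2 * B * n) * qFacInv (q ^ 2) n * qFacInv (q ^ 2) (B - n) := by
  have hp0 : 0 < q ^ 2 := by positivity
  have hp1 : q ^ 2 < 1 := pow_lt_one₀ hq0.le hq1 two_ne_zero
  rcases lt_or_ge n 0 with hn | hn
  · have : ∀ j, vdmTerm q B n j = 0 := by
      intro j
      rcases lt_or_ge j 0 with hj | hj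
      · simp [vdmTerm, qFacInv_of_neg hp0 hp1 hj]
      · simp [vdmTerm, qFacInv_of_neg hp0 hp1 (show n - j < 0 by omega)]
    simp [this, qFacInv_of_neg hp0 hp1 hn]
  lift n to ℕ using hn
  induction n with
  | zero =>
    rw [tsum_eq_single 0]
    · simp [vdmTerm, qFacInv_zero hp0 hp1]
    · intro j hj
      rcases lt_or_gt_of_ne hj with hj | hj
      · simp [vdmTerm, qFacInv_of_neg hp0 hp1 hj]
      · simp [vdmTerm, qFacInv_of_neg hp0 hp1 (show -j < 0 by omega)]
  | succ n ih =>
    have h0 : (1 - (q ^ 2) ^ ((n + 1 : ℕ) : ℤ)) ≠ 0 := by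
      rw [zpow_natCast]
      have := pow_lt_one₀ hp0.le hp1 n.succ_ne_zero
      exact (sub_pos.2 this).ne'
    have hrec := tsum_vdmTerm_rec hq0 hq1 B ((n + 1 : ℕ) : ℤ)
    have e0 : ((n + 1 : ℕ) : ℤ) - 1 = n := by push_cast; ring
    have f1 := qFacInv_mul_one_sub hp0 hp1 ((n + 1 : ℕ) : ℤ)
    have f2 := qFacInv_mul_one_sub hp0 hp1 (B - n)
    have e1 : B - (n : ℤ) - 1 = B - ((n + 1 : ℕ) : ℤ) := by push_cast; ring
    rw [e0] at hrec f1
    rw [e1] at f2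
    have e2 : (1 - q ^ (2 * (n : ℤ) - 2 * B)) = -(q ^ (2 * (n : ℤ) - 2 * B)
        * (1 - (q ^ 2) ^ (B - (n : ℤ)))) := by
      have : q ^ (2 * (n : ℤ) - 2 * B) * q ^ (2 * (B - (n : ℤ))) = 1 := by
        rw [← zpow_add₀ hq0.ne', show 2 * (n : ℤ) - 2 * B + 2 * (B - n) = 0 by ring, zpow_zero]
      rw [sq_zpow, mul_sub, this]
      ring
    have e3 : q ^ (((n + 1 : ℕ) : ℤ) * n - 2 * B * ((n + 1 : ℕ) : ℤ))
        = q ^ ((n : ℤ) * (n - 1) - 2 * B * n) * q ^ (2 * (n : ℤ) - 2 * B) := by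
      rw [← zpow_add₀ hq0.ne']; congr 1; push_cast; ring
    have e4 : (-1 : ℝ) ^ ((n + 1 : ℕ) : ℤ) = -(-1) ^ (n : ℤ) := by
      rw [zpow_natCast, zpow_natCast, pow_succ]; ring
    apply mul_left_cancel₀ h0
    rw [e0, e3, e4, ← f2]
    linear_combination qFacInv (q ^ 2) B * hrec + (1 - q ^ (2 * (n : ℤ) - 2 * B)) * ih
      + (-1) ^ (n : ℤ) * q ^ ((n : ℤ) * (n - 1) - 2 * B * n) * qFacInv (q ^ 2) n
        * qFacInv (q ^ 2) (B - n) * e2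
      + (-1) ^ (n : ℤ) * q ^ ((n : ℤ) * (n - 1) - 2 * B * n) * q ^ (2 * (n : ℤ) - 2 * B)
        * qFacInv (q ^ 2) (B - n) * (1 - (q ^ 2) ^ (B - (n : ℤ))) * f1

end Vandermonde

/-! ### Generating functions and moments of products of Bessel functions. -/

section Moments

variable {q x : ℝ}

/-- The coefficients of `1 / (y t; q²)_∞`. -/
noncomputable def invCoeff (q y : ℝ) (a : ℤ) : ℝ := y ^ a * qFacInv (q ^ 2) a

/-- The coefficients of `(q² y / t; q²)_∞`. -/
noncomputable def facCoeff (q y : ℝ) (b : ℤ) : ℝ :=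
  (-1) ^ b * q ^ (b * (b + 1)) * y ^ b * qFacInv (q ^ 2) b

lemma summable_invCoeff (hq0 : 0 < q) (hq1 : q < 1) {y : ℝ} (hy0 : 0 < y) (hy1 : y < 1) :
    Summable (invCoeff q y) := by
  have hp0 : 0 < q ^ 2 := by positivity
  have hp1 : q ^ 2 < 1 := pow_lt_one₀ hq0.le hq1 two_ne_zero
  obtain ⟨C, hC0, hC⟩ := exists_abs_qFacInv_le hp0 hp1
  refine Summable.of_nat_of_neg ?_ ?_
  · refine Summable.of_norm_bounded
      ((summable_geometric_of_lt_one hy0.le hy1).mul_right C) fun n => ?_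
    rw [invCoeff, norm_mul, zpow_natCast, Real.norm_of_nonneg (by positivity)]
    exact mul_le_mul_of_nonneg_left (hC n) (by positivity)
  · refine summable_of_ne_finset_zero (s := {0}) fun n hn => ?_
    rw [Finset.mem_singleton] at hn
    rw [invCoeff, qFacInv_of_neg hp0 hp1 (by omega), mul_zero]

lemma summable_facCoeff (hq0 : 0 < q) (hq1 : q < 1) {y : ℝ} (hy0 : 0 < y) :
    Summable (facCoeff q y) := by
  obtain ⟨C, hC0, hC⟩ := exists_abs_qFacInv_le (p := q ^ 2) (by positivity)
    (pow_lt_one₀ hq0.le hq1 two_ne_zero)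
  refine Summable.of_norm_bounded ((summable_zpow_mul_succ hq0 hq1 hy0).mul_right C) fun b => ?_
  rw [facCoeff, norm_mul, mul_assoc, norm_mul, Real.norm_eq_abs ((-1) ^ b), abs_neg_one_zpow,
    one_mul, Real.norm_of_nonneg (mul_pos (zpow_pos hq0 _) (zpow_pos hy0 _)).le]
  exact mul_le_mul_of_nonneg_left (hC b) (mul_pos (zpow_pos hq0 _) (zpow_pos hy0 _)).le

/-- The generating function `∑_n J_n(x) (ρt)^n = (q²x/(ρt); q²)_∞ / (ρxt; q²)_∞`, at the level of
coefficients. -/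
lemma tsum_invCoeff_mul_facCoeff (hx : 0 < x) {ρ : ℝ} (hρ : 0 < ρ) (n : ℤ) :
    ∑' b, invCoeff q (ρ * x) (n + b) * facCoeff q (ρ⁻¹ * x) b = ρ ^ n * besselInt q x n := by
  rw [besselInt, ← tsum_mul_left]
  refine tsum_congr fun b => ?_
  have e : (ρ * x) ^ (n + b) * (ρ⁻¹ * x) ^ b = ρ ^ n * x ^ (n + 2 * b) := by
    rw [mul_zpow, mul_zpow, inv_zpow, zpow_add₀ hρ.ne', show n + 2 * b = n + b + b by ring,
      zpow_add₀ hx.ne' (n + b)]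
    have := (zpow_pos hρ b).ne'
    field_simp
  rw [invCoeff, facCoeff, besselTerm]
  linear_combination (-1) ^ b * q ^ (b * (b + 1)) * qFacInv (q ^ 2) b
    * qFacInv (q ^ 2) (n + b) * e

/-- The condition on `ρσ` says `q²/σ = ρ q^{-2B}`, so after scaling `t` by `ρx` the quotient of
infinite products is the one summed by `vdmTerm`. -/
lemma tsum_invCoeff_sub_mul_facCoeff (hq0 : 0 < q) (hx : 0 < x) {ρ σ : ℝ} (hρ : 0 < ρ)
    (hσ : 0 < σ) {B : ℤ} (h : ρ * σ = q ^ (2 + 2 * B)) (n : ℤ) :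
    ∑' b, invCoeff q (ρ * x) (n - b) * facCoeff q (σ⁻¹ * x) b
      = (ρ * x) ^ n * ∑' j, vdmTerm q B n j := by
  rw [← tsum_mul_left]
  refine tsum_congr fun b => ?_
  have e : (ρ * x) ^ (n - b) * (σ⁻¹ * x) ^ b * q ^ (b * (b + 1))
      = (ρ * x) ^ n * q ^ (b * (b - 1) - 2 * B * b) := by
    have h1 : q ^ (b * (b + 1)) = q ^ (b * (b - 1) - 2 * B * b) * (ρ * σ) ^ b := by
      rw [h, ← zpow_mul, ← zpow_add₀ hq0.ne']; congr 1; ring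
    rw [h1, zpow_sub₀ (by positivity), mul_zpow σ⁻¹, inv_zpow, mul_zpow ρ x b, mul_zpow ρ σ]
    have h2 := (zpow_pos hρ b).ne'
    have h3 := (zpow_pos hσ b).ne'
    have h4 := (zpow_pos hx b).ne'
    field_simp
  rw [invCoeff, facCoeff, vdmTerm]
  linear_combination (-1) ^ b * qFacInv (q ^ 2) b * qFacInv (q ^ 2) (n - b) * e

/-- The weight `q^{(2+2B)r}` coming from `y^{2B}` is split between the factors as `q` and
`q^{1+2B}`: both geometric series then converge under `qx < 1`, and regrouping meets the condition
on `ρσ` in both pairs. -/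
lemma tsum_moment (hq0 : 0 < q) (hq1 : q < 1) (hx : 0 < x) (hqx : q * x < 1) (m : ℤ) (B : ℕ) :
    ∑' r : ℤ, q ^ (m + r) * besselInt q x (m + r)
        * ((q ^ (1 + 2 * (B : ℤ))) ^ r * besselInt q x r)
      = ∑' n : ℤ, (q ^ (1 + 2 * (B : ℤ)) * x) ^ n * (∑' j, vdmTerm q B n j)
        * ((q * x) ^ (m + n) * ∑' j, vdmTerm q B (m + n) j) := by
  have hρ : 0 < q ^ (1 + 2 * (B : ℤ)) := zpow_pos hq0 _
  have hρq : q ^ (1 + 2 * (B : ℤ)) ≤ q := by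
    simpa using zpow_le_zpow_right_of_le_one₀ hq0 hq1.le (show 1 ≤ 1 + 2 * (B : ℤ) by omega)
  have h := tsum_mul_tsum_conv (summable_invCoeff hq0 hq1 (mul_pos hq0 hx) hqx)
    (summable_facCoeff hq0 hq1 (mul_pos (inv_pos.2 hq0) hx))
    (summable_invCoeff hq0 hq1 (mul_pos hρ hx)
      ((mul_le_mul_of_nonneg_right hρq hx.le).trans_lt hqx))
    (summable_facCoeff hq0 hq1 (mul_pos (inv_pos.2 hρ) hx)) m
  have e1 : q ^ (1 + 2 * (B : ℤ)) * q = q ^ (2 + 2 * (B : ℤ)) := by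
    rw [← zpow_add_one₀ hq0.ne']; congr 1; ring
  have e2 : q * q ^ (1 + 2 * (B : ℤ)) = q ^ (2 + 2 * (B : ℤ)) := by rw [mul_comm, e1]
  simpa only [tsum_invCoeff_mul_facCoeff hx hq0, tsum_invCoeff_mul_facCoeff hx hρ,
    tsum_invCoeff_sub_mul_facCoeff hq0 hx hρ hq0 e1,
    tsum_invCoeff_sub_mul_facCoeff hq0 hx hq0 hρ e2] using h

end Moments

/-! ### The product formula with a factor of order zero. -/

section ProductFormula

variable {q x y : ℝ}

/-- The double series obtained by expanding `J_0` in
`∑_r q^{2r} J_{m+r}(x) J_r(x) J_0(y q^r)`. -/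
noncomputable def productTerm (q x y : ℝ) (m r B : ℤ) : ℝ :=
  q ^ (2 * r) * (besselInt q x (m + r) * besselInt q x r) * besselTerm q (y * q ^ r) 0 B

lemma abs_besselTerm_zero_le (hq0 : 0 < q) (hq1 : q < 1) :
    ∃ C, 0 ≤ C ∧ ∀ y, 0 < y → ∀ r B,
      |besselTerm q (y * q ^ r) 0 B| ≤ C * (q ^ (B * (B + 1)) * y ^ (2 * B) * q ^ (2 * r * B)) := by
  obtain ⟨C, hC0, hC⟩ := exists_abs_besselTerm_le hq0 hq1
  refine ⟨C, hC0, fun y hy r B => (hC _ (mul_pos hy (zpow_pos hq0 r)) 0 B).trans_eq ?_⟩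
  rw [zpow_zero, mul_one, mul_zpow, ← zpow_mul, show r * (2 * B) = 2 * r * B by ring]
  ring

lemma summable_zpow_mul_besselInt_mul (hq0 : 0 < q) (hq1 : q < 1) (hx : 0 < x) (hqx : q * x < 1)
    (m k : ℤ) :
    Summable fun r : ℤ => q ^ (2 * r) * (besselInt q x (m + r) * besselInt q x (k + r)) := by
  have hs := summable_zpow_mul_besselInt hq0 hq1 hx hq0 hqx
  have h1 : Summable fun r : ℤ => q ^ (k + r) * besselInt q x (k + r) :=
    (Equiv.addLeft k).summable_iff.2 hs
  refine Summable.of_norm_bounded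
    (h1.norm.mul_left (q ^ (-m - k) * ∑' n : ℤ, ‖q ^ n * besselInt q x n‖)) fun r => ?_
  have h2 : ‖q ^ (m + r) * besselInt q x (m + r)‖ ≤ ∑' n : ℤ, ‖q ^ n * besselInt q x n‖ :=
    hs.norm.le_tsum (m + r) fun _ _ => norm_nonneg _
  have e : q ^ (2 * r) * (besselInt q x (m + r) * besselInt q x (k + r)) = q ^ (-m - k) *
      (q ^ (m + r) * besselInt q x (m + r)) * (q ^ (k + r) * besselInt q x (k + r)) := by
    have : q ^ (2 * r) = q ^ (-m - k) * q ^ (m + r) * q ^ (k + r) := by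
      rw [← zpow_add₀ hq0.ne', ← zpow_add₀ hq0.ne']; congr 1; ring
    rw [this]; ring
  rw [e, norm_mul, norm_mul, Real.norm_of_nonneg (zpow_pos hq0 _).le]
  exact mul_le_mul_of_nonneg_right (mul_le_mul_of_nonneg_left h2 (zpow_pos hq0 _).le)
    (norm_nonneg _)

/-- The danger is `q^{2rB}` for `r < 0`. There both Bessel factors decay like `q^{r²}`; one such
factor completes the square to `q^{(B+r)(B+r+1)}` and the other remains for the sum over `r`. For `r
≥ 0` one has `q^{2rB} ≤ 1`. -/
lemma summable_productTerm (hq0 : 0 < q) (hq1 : q < 1) (hx : 0 < x) (hqx : q * x < 1)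
    (hy : 0 < y) (m : ℤ) :
    Summable fun z : ℤ × ℤ => productTerm q x y m z.1 z.2 := by
  have hp0 : 0 < q ^ 2 := by positivity
  have hp1 : q ^ 2 < 1 := pow_lt_one₀ hq0.le hq1 two_ne_zero
  obtain ⟨C, hC0, hC⟩ := abs_besselTerm_zero_le hq0 hq1
  obtain ⟨C₁, hC₁0, hC₁⟩ := exists_abs_besselInt_le_of_le hq0 hq1 hx m
  obtain ⟨C₂, hC₂0, hC₂⟩ := exists_abs_besselInt_le_of_le hq0 hq1 hx 0
  have hs := summable_zpow_mul_besselInt_mul hq0 hq1 hx hqx m 0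
  simp only [zero_add] at hs
  have hg₁ := hs.norm.mul_of_nonneg (summable_zpow_mul_succ_sq hq0 hq1 hy)
    (fun _ => norm_nonneg _) (fun B => (mul_pos (zpow_pos hq0 _) (zpow_pos hy _)).le)
  set A : ℝ := q ^ (2 * m - 1) * x ^ (-2 : ℤ) * y ^ (-2 : ℤ) with hA
  have hA0 : 0 < A := mul_pos (mul_pos (zpow_pos hq0 _) (zpow_pos hx _)) (zpow_pos hy _)
  have hg₂ := (summable_zpow_sq_mul_zpow hq0 hq1 hA0).mul_of_nonneg
    (summable_zpow_mul_succ_sq hq0 hq1 hy)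
    (fun B => (mul_pos (zpow_pos hq0 _) (zpow_pos hA0 _)).le)
    (fun B => (mul_pos (zpow_pos hq0 _) (zpow_pos hy _)).le)
  let e : ℤ × ℤ ≃ ℤ × ℤ :=
    ⟨fun z => (z.1, z.2 + z.1), fun z => (z.1, z.2 - z.1), fun z => by simp, fun z => by simp⟩
  have hg₂' := e.summable_iff.2 hg₂
  refine Summable.of_norm_bounded ((hg₁.mul_left C).add
    (hg₂'.mul_left (C₁ * C₂ * C * (q ^ (m * (m - 1)) * x ^ (-m))))) fun z => ?_
  obtain ⟨r, B⟩ := z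
  have p1 : 0 < q ^ (B * (B + 1)) := zpow_pos hq0 _
  have p2 : 0 < y ^ (2 * B) := zpow_pos hy _
  have p3 : 0 < q ^ (2 * r) := zpow_pos hq0 _
  have p4 : 0 < q ^ (2 * r * B) := zpow_pos hq0 _
  have n1 : 0 ≤ C * (‖q ^ (2 * r) * (besselInt q x (m + r) * besselInt q x r)‖
      * (q ^ (B * (B + 1)) * y ^ (2 * B))) := by positivity
  have n2 : 0 ≤ C₁ * C₂ * C * (q ^ (m * (m - 1)) * x ^ (-m))
      * (q ^ (r * r) * A ^ r * (q ^ ((B + r) * ((B + r) + 1)) * y ^ (2 * (B + r)))) := by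
    have := zpow_pos hq0 (m * (m - 1))
    have := zpow_pos hx (-m)
    have := zpow_pos hq0 (r * r)
    have := zpow_pos hA0 r
    have := zpow_pos hq0 ((B + r) * ((B + r) + 1))
    have := zpow_pos hy (2 * (B + r))
    positivity
  change ‖productTerm q x y m r B‖ ≤ C * (‖q ^ (2 * r) * (besselInt q x (m + r) * besselInt q x r)‖
      * (q ^ (B * (B + 1)) * y ^ (2 * B))) + C₁ * C₂ * C * (q ^ (m * (m - 1)) * x ^ (-m))
      * (q ^ (r * r) * A ^ r * (q ^ ((B + r) * ((B + r) + 1)) * y ^ (2 * (B + r))))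
  rcases lt_or_ge B 0 with hB | hB
  · have : productTerm q x y m r B = 0 := by
      simp [productTerm, besselTerm, qFacInv_of_neg hp0 hp1 hB]
    rw [this, norm_zero]
    exact add_nonneg n1 n2
  rw [productTerm, norm_mul]
  rcases lt_or_ge r 0 with hr | hr
  · refine le_trans ?_ (le_add_of_nonneg_left n1)
    rw [norm_mul, norm_mul, Real.norm_of_nonneg p3.le]
    have b1 := hC₁ (m + r) (by omega)
    have b2 := hC₂ r hr.le
    have b3 := hC y hy r B
    have e1 : q ^ (2 * r) * (q ^ ((m + r) * (m + r - 1)) * q ^ (r * (r - 1)))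
        * (q ^ (B * (B + 1)) * q ^ (2 * r * B)) = q ^ (m * (m - 1)) * q ^ (r * r)
          * (q ^ (2 * m - 1)) ^ r * q ^ ((B + r) * ((B + r) + 1)) := by
      rw [← zpow_mul]
      simp only [← zpow_add₀ hq0.ne']
      congr 1; ring
    have e2 : x ^ (-(m + r)) * x ^ (-r) = x ^ (-m) * (x ^ (-2 : ℤ)) ^ r := by
      rw [← zpow_mul, ← zpow_add₀ hx.ne', ← zpow_add₀ hx.ne']; congr 1; ring
    have e3 : y ^ (2 * B) = (y ^ (-2 : ℤ)) ^ r * y ^ (2 * (B + r)) := by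
      rw [← zpow_mul, ← zpow_add₀ hy.ne']; congr 1; ring
    have q1 : 0 < q ^ ((m + r) * (m + r - 1)) := zpow_pos hq0 _
    have q2 : 0 < x ^ (-(m + r)) := zpow_pos hx _
    calc _ ≤ q ^ (2 * r) * ((C₁ * (q ^ ((m + r) * (m + r - 1)) * x ^ (-(m + r))))
          * (C₂ * (q ^ (r * (r - 1)) * x ^ (-r))))
          * (C * (q ^ (B * (B + 1)) * y ^ (2 * B) * q ^ (2 * r * B))) := by
          refine mul_le_mul (mul_le_mul_of_nonneg_left (mul_le_mul b1 b2 (norm_nonneg _) ?_) p3.le)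
            b3 (norm_nonneg _) (mul_nonneg p3.le (mul_nonneg ?_ ((abs_nonneg _).trans b2)))
          all_goals positivity
      _ = C₁ * C₂ * C * (q ^ (2 * r) * (q ^ ((m + r) * (m + r - 1)) * q ^ (r * (r - 1)))
        * (q ^ (B * (B + 1)) * q ^ (2 * r * B))) * (x ^ (-(m + r)) * x ^ (-r)) * y ^ (2 * B) := by
          ring
      _ = _ := by
          rw [e1, e2, e3, hA, mul_zpow, mul_zpow]
          ring
  · refine le_trans ?_ (le_add_of_nonneg_right n2)
    have h1 : q ^ (2 * r * B) ≤ 1 := by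
      simpa using zpow_le_zpow_right_of_le_one₀ hq0 hq1.le (show 0 ≤ 2 * r * B by positivity)
    calc _ ≤ ‖q ^ (2 * r) * (besselInt q x (m + r) * besselInt q x r)‖
          * (C * (q ^ (B * (B + 1)) * y ^ (2 * B) * 1)) := by
          refine mul_le_mul_of_nonneg_left ((hC y hy r B).trans ?_) (norm_nonneg _)
          gcongr
      _ = _ := by ring

/-- Coefficient comparison at `y^{2B}`: the two factors `1/(q²; q²)_B` of `J_0` are exactly those
needed to evaluate the two `vdmTerm` sums of the moment. -/
lemma tsum_productTerm (hq0 : 0 < q) (hq1 : q < 1) (hx : 0 < x) (hqx : q * x < 1)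
    (hy : 0 < y) (m B : ℤ) :
    ∑' r, productTerm q x y m r B
      = ∑' n, besselTerm q (x * y) m n * besselTerm q y m (B - m - n) := by
  have hp0 : 0 < q ^ 2 := by positivity
  have hp1 : q ^ 2 < 1 := pow_lt_one₀ hq0.le hq1 two_ne_zero
  rcases lt_or_ge B 0 with hB | hB
  · have h1 : ∀ r, productTerm q x y m r B = 0 := fun r => by
      simp [productTerm, besselTerm, qFacInv_of_neg hp0 hp1 hB]
    have h2 : ∀ n, besselTerm q (x * y) m n * besselTerm q y m (B - m - n) = 0 := fun n => by
      rcases lt_or_ge n 0 with hn | hn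
      · simp [besselTerm, qFacInv_of_neg hp0 hp1 hn]
      · simp [besselTerm, qFacInv_of_neg hp0 hp1 (show m + (B - m - n) < 0 by omega)]
    simp [h1, h2]
  lift B to ℕ using hB
  have hmom := tsum_moment hq0 hq1 hx hqx m B
  set c : ℝ := (-1) ^ (B : ℤ) * q ^ ((B : ℤ) * (B + 1)) * y ^ (2 * (B : ℤ))
    * qFacInv (q ^ 2) B * qFacInv (q ^ 2) B * q ^ (-m) with hc
  have h1 : ∀ r, productTerm q x y m r B = c * (q ^ (m + r) * besselInt q x (m + r)
        * ((q ^ (1 + 2 * (B : ℤ))) ^ r * besselInt q x r)) := by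
    intro r
    have e1 : q ^ (2 * r) * q ^ (r * (2 * (B : ℤ)))
        = q ^ (-m) * q ^ (m + r) * (q ^ (1 + 2 * (B : ℤ))) ^ r := by
      rw [← zpow_mul]
      simp only [← zpow_add₀ hq0.ne']
      congr 1; ring
    simp only [productTerm, besselTerm, zero_add]
    rw [mul_zpow y, ← zpow_mul q r, hc]
    linear_combination (-1) ^ (B : ℤ) * q ^ ((B : ℤ) * (B + 1)) * y ^ (2 * (B : ℤ))
      * qFacInv (q ^ 2) B * qFacInv (q ^ 2) B * besselInt q x (m + r) * besselInt q x r * e1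
  rw [tsum_congr h1, tsum_mul_left, hmom, ← tsum_mul_left]
  refine tsum_congr fun n => ?_
  have v1 := qFacInv_mul_tsum_vdmTerm hq0 hq1 B n
  have v2 := qFacInv_mul_tsum_vdmTerm hq0 hq1 B (m + n)
  have eq1 : q ^ ((B : ℤ) * (B + 1)) * q ^ (-m) * (q ^ (1 + 2 * (B : ℤ))) ^ n * q ^ (m + n)
      * q ^ (n * (n - 1) - 2 * (B : ℤ) * n) * q ^ ((m + n) * (m + n - 1) - 2 * (B : ℤ) * (m + n))
      = q ^ (n * (n + 1)) * q ^ (((B : ℤ) - m - n) * ((B : ℤ) - m - n + 1)) := by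
    rw [← zpow_mul]
    simp only [← zpow_add₀ hq0.ne']
    congr 1; ring
  have eq2 : x ^ n * x ^ (m + n) * y ^ (2 * (B : ℤ))
      = (x * y) ^ (m + 2 * n) * y ^ (m + 2 * ((B : ℤ) - m - n)) := by
    rw [mul_zpow, ← zpow_add₀ hx.ne', mul_assoc, ← zpow_add₀ hy.ne']
    congr 2 <;> ring
  have eq3 : (-1 : ℝ) ^ (B : ℤ) * (-1) ^ n * (-1) ^ (m + n)
      = (-1) ^ n * (-1) ^ ((B : ℤ) - m - n) := by
    have h : (-1 : ℝ) ≠ 0 := by norm_num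
    have h2 : ((-1 : ℝ) ^ (m + n)) * (-1) ^ (m + n) = 1 := by
      rw [← mul_zpow]; norm_num
    rw [show (B : ℤ) - m - n = B - (m + n) by ring, zpow_sub₀ h]
    field_simp
    linear_combination h2
  have eq4 : m + ((B : ℤ) - m - n) = B - n := by ring
  have eq5 : (B : ℤ) - (m + n) = B - m - n := by ring
  rw [eq5] at v2
  simp only [besselTerm]
  rw [hc, mul_zpow, mul_zpow q x, eq4]
  calc _ = (-1) ^ (B : ℤ) * (q ^ ((B : ℤ) * (B + 1)) * q ^ (-m) * (q ^ (1 + 2 * (B : ℤ))) ^ n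
        * q ^ (m + n)) * (x ^ n * x ^ (m + n) * y ^ (2 * (B : ℤ)))
        * (qFacInv (q ^ 2) B * ∑' j, vdmTerm q B n j)
        * (qFacInv (q ^ 2) B * ∑' j, vdmTerm q B (m + n) j) := by ring
    _ = ((-1) ^ (B : ℤ) * (-1) ^ n * (-1) ^ (m + n))
        * (q ^ ((B : ℤ) * (B + 1)) * q ^ (-m) * (q ^ (1 + 2 * (B : ℤ))) ^ n * q ^ (m + n)
      * q ^ (n * (n - 1) - 2 * (B : ℤ) * n) * q ^ ((m + n) * (m + n - 1) - 2 * (B : ℤ) * (m + n)))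
        * (x ^ n * x ^ (m + n) * y ^ (2 * (B : ℤ))) * qFacInv (q ^ 2) n * qFacInv (q ^ 2) (B - n)
        * qFacInv (q ^ 2) (m + n) * qFacInv (q ^ 2) (B - m - n) := by rw [v1, v2]; ring
    _ = _ := by rw [eq1, eq2, eq3]; ring

/-- The Cauchy product is grouped by `B = m + n + a`, with `n`, `a` the two summation indices,
because `(xy)^{m+2n} y^{m+2a}` contains `y^{2B}`. -/
lemma tsum_besselTerm_mul (hq0 : 0 < q) (hq1 : q < 1) (hx : 0 < x) (hy : 0 < y) (m : ℤ) :
    besselInt q x m * besselInt q y m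
      = ∑' B, ∑' n, besselTerm q x m n * besselTerm q y m (B - m - n) := by
  have s1 := (summable_besselTerm hq0 hq1 hx m).norm
  have s2 := (summable_besselTerm hq0 hq1 hy m).norm
  have hsum : Summable fun z : ℤ × ℤ => besselTerm q x m z.1 * besselTerm q y m z.2 :=
    summable_mul_of_summable_norm s1 s2
  have h1 : ∀ n, ∑' a, besselTerm q x m n * besselTerm q y m a
      = ∑' B, besselTerm q x m n * besselTerm q y m (B - m - n) := fun n => by
    rw [← ((Equiv.subRight m).trans (Equiv.subRight n)).tsum_eq]
    rfl
  let e : ℤ × ℤ ≃ ℤ × ℤ :=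
    ⟨fun z => (z.2, z.1 - m - z.2), fun z => (z.2 + m + z.1, z.1), fun z => by ext <;> simp; ring,
      fun z => by ext <;> simp; ring⟩
  have hsum' : Summable (Function.uncurry fun B n =>
      besselTerm q x m n * besselTerm q y m (B - m - n)) := e.summable_iff.2 hsum
  rw [besselInt, besselInt, tsum_mul_tsum_of_summable_norm s1 s2, hsum.tsum_prod, tsum_congr h1]
  exact hsum'.tsum_comm

/-- A product formula for Hahn-Exton `q`-Bessel functions of integer order. -/
theorem tsum_besselInt_mul_besselInt_mul_besselInt_zero (hq0 : 0 < q) (hq1 : q < 1) (hx : 0 < x)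
    (hqx : q * x < 1) (hy : 0 < y) (m : ℤ) :
    ∑' r : ℤ, q ^ (2 * r) * (besselInt q x (m + r) * besselInt q x r) * besselInt q (y * q ^ r) 0
      = besselInt q (x * y) m * besselInt q y m := by
  have h1 : ∀ r : ℤ, q ^ (2 * r) * (besselInt q x (m + r) * besselInt q x r)
      * besselInt q (y * q ^ r) 0 = ∑' B, productTerm q x y m r B := fun r => by
    exact tsum_mul_left.symm
  have hs := summable_productTerm hq0 hq1 hx hqx hy m
  have hs' : Summable (Function.uncurry fun r B => productTerm q x y m r B) := hs
  rw [tsum_congr h1, ← hs'.tsum_comm, tsum_congr fun B => tsum_productTerm hq0 hq1 hx hqx hy m B]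
  exact (tsum_besselTerm_mul hq0 hq1 (mul_pos hx hy) hy m).symm

end ProductFormula

/-! ### Real order: Sonine sum, integrand and Graf kernel. -/

section RealOrder

variable {q v : ℝ}

/-- The normalizing constant `(q^{2v+2}; q²)_∞ / (q²; q²)_∞`. -/
noncomputable def besselNorm (q v : ℝ) : ℝ :=
  qPochInf ((q ^ 2) ^ (v + 1)) (q ^ 2) / qPochInf (q ^ 2) (q ^ 2)

lemma besselNorm_ne_zero (hq0 : 0 < q) (hq1 : q < 1) (hv : -1 < v) : besselNorm q v ≠ 0 := by
  have hp1 : q ^ 2 < 1 := pow_lt_one₀ hq0.le hq1 two_ne_zero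
  exact div_ne_zero (qPochInf_ne_zero (sq_nonneg q) hp1 (by positivity)
    (Real.rpow_lt_one (sq_nonneg q) hp1 (by linarith)))
    (qPochInf_ne_zero (sq_nonneg q) hp1 (sq_nonneg q) hp1)

/-- The coefficients of the power series of `j_v(x, q²)` in `x²`. -/
noncomputable def normalizedCoeff (q v : ℝ) (s : ℕ) : ℝ :=
  (-1) ^ s * ((q ^ 2) ^ (s * (s + 1) / 2)
    / (qPoch (q ^ 2) (q ^ 2) s * qPoch ((q ^ 2) ^ (v + 1)) (q ^ 2) s))

lemma sq_pow_half (q : ℝ) (s : ℕ) : (q ^ 2) ^ (s * (s + 1) / 2) = q ^ (s * (s + 1)) := by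
  rw [← pow_mul, Nat.mul_div_cancel' (Nat.even_mul_succ_self s).two_dvd]

lemma hahnExtonJ_eq_mul_normalizedJ (hq0 : 0 < q) (hq1 : q < 1) (hv : -1 < v) (z : ℝ) :
    hahnExtonJ v z (q ^ 2) = besselNorm q v * z ^ v * normalizedJ v z (q ^ 2) := by
  have hp0 : 0 < q ^ 2 := by positivity
  have hp1 : q ^ 2 < 1 := pow_lt_one₀ hq0.le hq1 two_ne_zero
  have hw1 : (q ^ 2) ^ (v + 1) < 1 := Real.rpow_lt_one hp0.le hp1 (by linarith)
  have hw0 : 0 < (q ^ 2) ^ (v + 1) := Real.rpow_pos_of_pos hp0 _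
  rw [hahnExtonJ, normalizedJ, besselNorm, ← tsum_mul_left, ← tsum_mul_left]
  refine tsum_congr fun r => ?_
  rw [Real.rpow_add hp0 (v + 1), Real.rpow_natCast,
    qPochInf_eq_qPoch_mul hp0.le hp1 ((q ^ 2) ^ (v + 1)) r]
  have h1 := qPoch_ne_zero hp0.le hp1 hw0.le hw1 r
  field_simp

lemma besselInt_eq_mul_normalizedJ (hq0 : 0 < q) (hq1 : q < 1) (hv : -1 < v) (r : ℤ) :
    besselInt q (q ^ v) r = besselNorm q v * (q ^ v) ^ r * normalizedJ v (q ^ r) (q ^ 2) := by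
  rw [← hahnExtonJ_zpow hq0 hq1, hahnExtonJ_eq_mul_normalizedJ hq0 hq1 hv, ← Real.rpow_intCast,
    ← Real.rpow_intCast, ← Real.rpow_mul hq0.le, ← Real.rpow_mul hq0.le, mul_comm v]

lemma normalizedJ_zero_order (hq0 : 0 < q) (hq1 : q < 1) (y : ℝ) :
    normalizedJ 0 y (q ^ 2) = besselInt q y 0 := by
  have hp0 : 0 < q ^ 2 := by positivity
  have hp1 : q ^ 2 < 1 := pow_lt_one₀ hq0.le hq1 two_ne_zero
  rw [besselInt, tsum_int_eq_tsum_nat fun n hn => by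
    simp [besselTerm, qFacInv_of_neg hp0 hp1 hn], normalizedJ]
  refine tsum_congr fun s => ?_
  have h1 : q ^ ((s : ℤ) * ((s : ℤ) + 1)) = q ^ (s * (s + 1)) := by
    rw [← zpow_natCast]; norm_cast
  have h2 : y ^ (2 * (s : ℤ)) = y ^ (2 * s) := by rw [← zpow_natCast]; norm_cast
  rw [besselTerm, zero_add, zero_add, zero_add, Real.rpow_one, qFacInv_natCast hp0 hp1, h1, h2,
    sq_pow_half, zpow_natCast, div_eq_mul_inv, mul_inv]
  ring

/-- The symmetry turns the bound `|J_r(x)| ≤ C x^r` at `x = q^v` into boundedness on the whole grid,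
including `r → -∞`, where the argument is unbounded. -/
lemma exists_abs_normalizedJ_zpow_le (hq0 : 0 < q) (hq1 : q < 1) (hv : -1 < v) :
    ∃ C, 0 ≤ C ∧ ∀ r : ℤ, |normalizedJ v (q ^ r) (q ^ 2)| ≤ C := by
  have hx : 0 < q ^ v := Real.rpow_pos_of_pos hq0 v
  obtain ⟨C, hC0, hC⟩ := exists_abs_besselInt_le hq0 hq1 hx
  have hg := abs_pos.2 (besselNorm_ne_zero hq0 hq1 hv)
  refine ⟨C / |besselNorm q v|, by positivity, fun r => ?_⟩
  have h := hC r
  have hxr := zpow_pos hx r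
  rw [besselInt_eq_mul_normalizedJ hq0 hq1 hv, abs_mul, abs_mul, abs_of_pos hxr] at h
  rw [le_div_iff₀ hg]
  refine le_of_mul_le_mul_right ?_ hxr
  calc _ = _ := by ring
    _ ≤ _ := h

lemma exists_abs_normalizedCoeff_le (hq0 : 0 < q) (hq1 : q < 1) (hv : -1 < v) :
    ∃ C, 0 ≤ C ∧ ∀ s, |normalizedCoeff q v s| ≤ C * q ^ (s * (s + 1)) := by
  have hp0 : 0 < q ^ 2 := by positivity
  have hp1 : q ^ 2 < 1 := pow_lt_one₀ hq0.le hq1 two_ne_zero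
  have hw1 : (q ^ 2) ^ (v + 1) < 1 := Real.rpow_lt_one hp0.le hp1 (by linarith)
  have hw0 : 0 < (q ^ 2) ^ (v + 1) := Real.rpow_pos_of_pos hp0 _
  obtain ⟨C, hC0, hC⟩ := exists_abs_le_of_tendsto
    (((tendsto_qPoch hp0.le hp1 (q ^ 2)).mul (tendsto_qPoch hp0.le hp1 ((q ^ 2) ^ (v + 1)))).inv₀
      (mul_ne_zero (qPochInf_ne_zero hp0.le hp1 hp0.le hp1)
        (qPochInf_ne_zero hp0.le hp1 hw0.le hw1)))
  refine ⟨C, hC0, fun s => ?_⟩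
  rw [normalizedCoeff, abs_mul, abs_pow, abs_neg, abs_one, one_pow, one_mul, sq_pow_half,
    div_eq_mul_inv, abs_mul, abs_of_nonneg (by positivity), mul_comm C]
  exact mul_le_mul_of_nonneg_left (hC s) (by positivity)

lemma summable_normalizedCoeff (hq0 : 0 < q) (hq1 : q < 1) (hv : -1 < v) {y : ℝ} (hy : 0 < y) :
    Summable fun s => normalizedCoeff q v s * y ^ (2 * s) := by
  obtain ⟨C, hC0, hC⟩ := exists_abs_normalizedCoeff_le hq0 hq1 hv
  refine Summable.of_norm_bounded
    ((summable_pow_mul_succ hq0 hq1 (A := y ^ 2) (by positivity)).mul_left C) fun s => ?_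
  rw [norm_mul, Real.norm_of_nonneg (by positivity : 0 ≤ y ^ (2 * s)), ← mul_assoc, ← pow_mul]
  exact mul_le_mul_of_nonneg_right (hC s) (by positivity)

/-- The weights of the `q`-analogue of Sonine's first integral, lowering the order from `v`
to `0`. -/
noncomputable def sonineCoeff (q v : ℝ) (i : ℕ) : ℝ :=
  qPoch (q ^ (-2 * v)) (q ^ 2) i / qPoch (q ^ 2) (q ^ 2) i * q ^ ((i : ℝ) * (2 + 2 * v))

lemma sonineCoeff_eq (hq0 : 0 < q) (i : ℕ) :
    sonineCoeff q v i = qPoch (q ^ (-2 * v)) (q ^ 2) i / qPoch (q ^ 2) (q ^ 2) i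
      * ((q ^ 2) ^ (v + 1)) ^ i := by
  rw [sonineCoeff, ← Real.rpow_natCast q 2, ← Real.rpow_mul hq0.le, ← Real.rpow_natCast (q ^ _) i,
    ← Real.rpow_mul hq0.le]
  congr 2
  push_cast
  ring

lemma summable_sonineCoeff (hq0 : 0 < q) (hq1 : q < 1) (hv : -1 < v) :
    Summable (sonineCoeff q v) := by
  have hp0 : 0 < q ^ 2 := by positivity
  have hp1 : q ^ 2 < 1 := pow_lt_one₀ hq0.le hq1 two_ne_zero
  have hw1 : (q ^ 2) ^ (v + 1) < 1 := Real.rpow_lt_one hp0.le hp1 (by linarith)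
  have hw0 : 0 < (q ^ 2) ^ (v + 1) := Real.rpow_pos_of_pos hp0 _
  obtain ⟨C, hC0, hC⟩ := exists_abs_qPoch_div_le hp0.le hp1 (q ^ (-2 * v))
  refine Summable.of_norm_bounded ((summable_geometric_of_lt_one hw0.le hw1).mul_left C)
    fun i => ?_
  rw [sonineCoeff_eq hq0, norm_mul, Real.norm_of_nonneg (pow_pos hw0 i).le]
  exact mul_le_mul_of_nonneg_right (hC i) (pow_pos hw0 i).le

/-- The `q`-binomial theorem with `a = q^{-2v}`, `z = q^{2v+2+2s}`: here `az = q^{2+2s}`, so the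
quotient replaces `(q^{2v+2}; q²)_s` by `(q²; q²)_s`, up to `N`. -/
lemma tsum_sonineCoeff_mul_pow (hq0 : 0 < q) (hq1 : q < 1) (hv : -1 < v) (s : ℕ) :
    ∑' i, sonineCoeff q v i * ((q ^ 2) ^ s) ^ i * normalizedCoeff q v s
      = (besselNorm q v)⁻¹ * normalizedCoeff q 0 s := by
  have hp0 : 0 < q ^ 2 := by positivity
  have hp1 : q ^ 2 < 1 := pow_lt_one₀ hq0.le hq1 two_ne_zero
  have hw1 : (q ^ 2) ^ (v + 1) < 1 := Real.rpow_lt_one hp0.le hp1 (by linarith)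
  have hw0 : 0 < (q ^ 2) ^ (v + 1) := Real.rpow_pos_of_pos hp0 _
  have hz0 : 0 ≤ (q ^ 2) ^ (v + 1) * (q ^ 2) ^ s := by positivity
  have hz1 : (q ^ 2) ^ (v + 1) * (q ^ 2) ^ s < 1 :=
    (mul_le_of_le_one_right hw0.le (pow_le_one₀ hp0.le hp1.le)).trans_lt hw1
  have haw : q ^ (-2 * v) * (q ^ 2) ^ (v + 1) = q ^ 2 := by
    rw [← Real.rpow_natCast q 2, ← Real.rpow_mul hq0.le, ← Real.rpow_add hq0]
    congr 1; push_cast; ring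
  have h := tsum_qPoch_div_mul_pow hp0 hp1 (q ^ (-2 * v)) hz0 hz1
  rw [← mul_assoc, haw] at h
  have e1 := qPochInf_eq_qPoch_mul hp0.le hp1 (q ^ 2) s
  have e2 := qPochInf_eq_qPoch_mul hp0.le hp1 ((q ^ 2) ^ (v + 1)) s
  have n1 := qPochInf_ne_zero hp0.le hp1 hp0.le hp1
  have n2 := qPochInf_ne_zero hp0.le hp1 hw0.le hw1
  have n3 := qPoch_ne_zero hp0.le hp1 hp0.le hp1 s
  have n4 := qPoch_ne_zero hp0.le hp1 hw0.le hw1 s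
  have h' : ∑' i, sonineCoeff q v i * ((q ^ 2) ^ s) ^ i
      = qPochInf (q ^ 2 * (q ^ 2) ^ s) (q ^ 2)
        / qPochInf ((q ^ 2) ^ (v + 1) * (q ^ 2) ^ s) (q ^ 2) := by
    rw [← h]
    refine tsum_congr fun i => ?_
    rw [sonineCoeff_eq hq0, mul_pow]
    ring
  rw [tsum_mul_right, h', besselNorm, e1, e2, normalizedCoeff, normalizedCoeff, zero_add,
    Real.rpow_one]
  rw [e1] at n1
  rw [e2] at n2
  have n5 := right_ne_zero_of_mul n1
  have n6 := right_ne_zero_of_mul n2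
  generalize qPochInf (q ^ 2 * (q ^ 2) ^ s) (q ^ 2) = P₁ at *
  generalize qPochInf ((q ^ 2) ^ (v + 1) * (q ^ 2) ^ s) (q ^ 2) = P₂ at *
  generalize qPoch (q ^ 2) (q ^ 2) s = P₃ at *
  generalize qPoch ((q ^ 2) ^ (v + 1)) (q ^ 2) s = P₄ at *
  generalize (q ^ 2) ^ (s * (s + 1) / 2) = P₅ at *
  field_simp

/-- A `q`-analogue of Sonine's first integral. -/
lemma tsum_sonineCoeff_mul_normalizedJ (hq0 : 0 < q) (hq1 : q < 1) (hv : -1 < v) {y : ℝ}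
    (hy : 0 < y) :
    ∑' i : ℕ, sonineCoeff q v i * normalizedJ v (q ^ i * y) (q ^ 2)
      = (besselNorm q v)⁻¹ * normalizedJ 0 y (q ^ 2) := by
  have e0 : ∀ u z, normalizedJ u z (q ^ 2) = ∑' s, normalizedCoeff q u s * z ^ (2 * s) :=
    fun u z => rfl
  have hs : Summable (Function.uncurry fun (i : ℕ) (s : ℕ) =>
      sonineCoeff q v i * (normalizedCoeff q v s * (q ^ i * y) ^ (2 * s))) := by
    refine Summable.of_norm_bounded ((summable_sonineCoeff hq0 hq1 hv).norm.mul_norm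
      (summable_normalizedCoeff hq0 hq1 hv hy).norm) fun z => ?_
    rw [Function.uncurry, mul_pow, mul_left_comm (normalizedCoeff q v z.2),
      mul_left_comm (sonineCoeff q v z.1), norm_mul ((q ^ z.1) ^ (2 * z.2))]
    refine mul_le_of_le_one_left (norm_nonneg _) ?_
    rw [Real.norm_of_nonneg (by positivity)]
    exact pow_le_one₀ (by positivity) (pow_le_one₀ hq0.le hq1.le)
  calc _ = ∑' (i : ℕ) (s : ℕ),
        sonineCoeff q v i * (normalizedCoeff q v s * (q ^ i * y) ^ (2 * s)) := by
        refine tsum_congr fun i => ?_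
        rw [e0, tsum_mul_left]
    _ = ∑' (s : ℕ) (i : ℕ),
        sonineCoeff q v i * (normalizedCoeff q v s * (q ^ i * y) ^ (2 * s)) := hs.tsum_comm.symm
    _ = ∑' s : ℕ, (besselNorm q v)⁻¹ * (normalizedCoeff q 0 s * y ^ (2 * s)) := by
        refine tsum_congr fun s => ?_
        rw [← mul_assoc, ← tsum_sonineCoeff_mul_pow hq0 hq1 hv, ← tsum_mul_right]
        refine tsum_congr fun i => ?_
        have : (q ^ i * y) ^ (2 * s) = ((q ^ 2) ^ s) ^ i * y ^ (2 * s) := by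
          rw [mul_pow, ← pow_mul, ← pow_mul, ← pow_mul]; ring_nf
        rw [this]; ring
    _ = _ := by rw [tsum_mul_left, e0]

lemma cConst_eq (hq0 : 0 < q) (v : ℝ) : cConst q v = besselNorm q v / (1 - q) := by
  have : q ^ (2 * v + 2) = (q ^ 2) ^ (v + 1) := by
    rw [← Real.rpow_natCast q 2, ← Real.rpow_mul hq0.le]; congr 1; push_cast; ring
  rw [cConst, besselNorm, this]
  ring

lemma besselNorm_zero (hq0 : 0 < q) (hq1 : q < 1) : besselNorm q 0 = 1 := by
  have hp1 : q ^ 2 < 1 := pow_lt_one₀ hq0.le hq1 two_ne_zero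
  rw [besselNorm, zero_add, Real.rpow_one,
    div_self (qPochInf_ne_zero (sq_nonneg q) hp1 (sq_nonneg q) hp1)]

/-- The power `t^{2v}` is what converts two of the three `j_v` into Bessel functions; the factor
carrying `l` stays normalized, ready for the Sonine sum. -/
lemma zpow_mul_kernelIntegrand (hq0 : 0 < q) (hq1 : q < 1) (hv : -1 < v) (m l k r : ℤ) :
    q ^ r * kernelIntegrand q v (q ^ m) (q ^ l) (q ^ k) (q ^ r)
      = (besselNorm q v ^ 2)⁻¹ * (q ^ v) ^ (-m - k) *
        (q ^ (2 * r) * (besselInt q (q ^ v) (m + r) * besselInt q (q ^ v) (k + r)))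
          * normalizedJ v (q ^ (l + r)) (q ^ 2) := by
  have hx : 0 < q ^ v := Real.rpow_pos_of_pos hq0 v
  have hg := besselNorm_ne_zero hq0 hq1 hv
  have e1 : q ^ r * (q ^ r) ^ (2 * v + 1)
      = (q ^ v) ^ (-m - k) * q ^ (2 * r) * (q ^ v) ^ (m + r) * (q ^ v) ^ (k + r) := by
    have : (q ^ v) ^ (-m - k) * q ^ (2 * r) * (q ^ v) ^ (m + r) * (q ^ v) ^ (k + r)
        = q ^ (2 * r) * (q ^ v) ^ (2 * r) := by
      rw [mul_comm ((q ^ v) ^ (-m - k)), mul_assoc, mul_assoc, ← zpow_add₀ hx.ne',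
        ← zpow_add₀ hx.ne']
      congr 2; ring
    rw [this]
    simp only [← Real.rpow_intCast, ← Real.rpow_mul hq0.le, ← Real.rpow_add hq0]
    congr 1; push_cast; ring
  rw [kernelIntegrand, ← zpow_add₀ hq0.ne', ← zpow_add₀ hq0.ne', ← zpow_add₀ hq0.ne',
    besselInt_eq_mul_normalizedJ hq0 hq1 hv, besselInt_eq_mul_normalizedJ hq0 hq1 hv]
  generalize normalizedJ v (q ^ (m + r)) (q ^ 2) = j₁
  generalize normalizedJ v (q ^ (l + r)) (q ^ 2) = j₂
  generalize normalizedJ v (q ^ (k + r)) (q ^ 2) = j₃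
  have e2 : (besselNorm q v ^ 2)⁻¹ * besselNorm q v ^ 2 = 1 := inv_mul_cancel₀ (pow_ne_zero 2 hg)
  linear_combination j₁ * j₂ * j₃ * e1 - j₁ * j₂ * j₃ * (q ^ v) ^ (-m - k) * q ^ (2 * r)
    * (q ^ v) ^ (m + r) * (q ^ v) ^ (k + r) * e2

lemma rpow_mul_self_lt_one (hq0 : 0 < q) (hq1 : q < 1) (hv : -1 < v) : q * q ^ v < 1 := by
  rw [← Real.rpow_one_add' hq0.le (by linarith)]
  exact Real.rpow_lt_one hq0.le hq1 (by linarith)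

/-- The product formula, in the form of a `q`-integral over products of functions of order
`v`, `v` and `0`. -/
lemma tsum_zpow_mul_besselInt_mul_zero (hq0 : 0 < q) (hq1 : q < 1) (hv : -1 < v) (m n k : ℤ) :
    ∑' r : ℤ, q ^ (2 * r) * (besselInt q (q ^ v) (m + r) * besselInt q (q ^ v) (k + r))
        * besselInt q (q ^ (n + r)) 0
      = q ^ (-2 * k) * (besselInt q (q ^ v * q ^ (n - k)) (m - k)
        * besselInt q (q ^ (n - k)) (m - k)) := by
  -- The shift `r ↦ r - k` brings the second order to `r`; it costs `q^{-2k}`.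
  rw [← tsum_besselInt_mul_besselInt_mul_besselInt_zero hq0 hq1 (Real.rpow_pos_of_pos hq0 v)
    (rpow_mul_self_lt_one hq0 hq1 hv) (zpow_pos hq0 (n - k)) (m - k), ← tsum_mul_left,
    ← (Equiv.subRight k).tsum_eq]
  refine tsum_congr fun r => ?_
  have e1 : m + (r - k) = m - k + r := by ring
  have e2 : q ^ (2 * (r - k)) = q ^ (-2 * k) * q ^ (2 * r) := by
    rw [← zpow_add₀ hq0.ne']; congr 1; ring
  have e3 : q ^ (n + (r - k)) = q ^ (n - k) * q ^ r := by
    rw [← zpow_add₀ hq0.ne']; congr 1; ring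
  rw [Equiv.subRight_apply, e1, e2, e3, add_sub_cancel]
  ring

lemma grafKernel_self (hq0 : 0 < q) (hq1 : q < 1) (m n k : ℤ) :
    grafKernel q v v m n k = (besselNorm q v)⁻¹ * (q ^ (-2 * k) * (q ^ v) ^ (-m - k)) *
      (besselInt q (q ^ v * q ^ (n - k)) (m - k) * besselInt q (q ^ (n - k)) (m - k)) := by
  have h1 : q ^ (v - v + (m : ℝ) - k) = q ^ (m - k) := by
    rw [sub_self, zero_add, ← Real.rpow_intCast]; push_cast; rfl
  have h2 : q ^ ((m : ℝ) - k) = q ^ (m - k) := by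
    rw [← Real.rpow_intCast]; push_cast; rfl
  have h3 : q ^ ((n : ℝ) - k) = q ^ (n - k) := by
    rw [← Real.rpow_intCast]; push_cast; rfl
  have h4 : q ^ (v + (n : ℝ) - k) = q ^ v * q ^ (n - k) := by
    rw [← h3, ← Real.rpow_add hq0]; congr 1; ring
  have h5 : q ^ (-(k : ℝ) * (v + 2) - (m : ℝ) * v - (n : ℝ) * (v - v))
      = q ^ (-2 * k) * (q ^ v) ^ (-m - k) := by
    rw [← Real.rpow_intCast, ← Real.rpow_intCast, ← Real.rpow_mul hq0.le, ← Real.rpow_add hq0]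
    congr 1; push_cast; ring
  have hq : (1 - q) ≠ 0 := (sub_pos.2 hq1).ne'
  rw [grafKernel, h1, h2, h5, hahnExtonJ_zpow hq0 hq1, hahnExtonJ_zpow hq0 hq1, h3, h4,
    cConst_eq hq0, cConst_eq hq0, sub_self, besselNorm_zero hq0 hq1]
  have : 1 / ((1 - q) ^ 2 * (besselNorm q v / (1 - q)) * (1 / (1 - q))) = (besselNorm q v)⁻¹ := by
    field_simp
  rw [this]
  ring

end RealOrder

end QBessel

/-! ### Assembly of the theorem. -/

open QBessel in
theorem proposition4 (q : ℝ) (hq0 : 0 < q) (hq1 : q < 1) (v : ℝ) (hv : -1 < v) (n m k : ℤ) :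
    (∀ i : ℕ, QBessel.JacksonIntegrable q
      (QBessel.kernelIntegrand q v (q ^ m) (q ^ ((i : ℤ) + n)) (q ^ k))) ∧
    (Summable fun i : ℕ =>
      QBessel.qPoch (q ^ (-2 * v)) (q ^ 2) i / QBessel.qPoch (q ^ 2) (q ^ 2) i *
        q ^ ((i : ℝ) * (2 + 2 * v)) *
        QBessel.translationKernel q v (q ^ m) (q ^ ((i : ℤ) + n)) (q ^ k)) ∧
    QBessel.grafKernel q v v m n k =
      (1 - q) * ∑' i : ℕ,
        QBessel.qPoch (q ^ (-2 * v)) (q ^ 2) i / QBessel.qPoch (q ^ 2) (q ^ 2) i *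
          q ^ ((i : ℝ) * (2 + 2 * v)) *
          QBessel.translationKernel q v (q ^ m) (q ^ ((i : ℤ) + n)) (q ^ k) := by
  have hx : 0 < q ^ v := Real.rpow_pos_of_pos hq0 v
  have hg := besselNorm_ne_zero hq0 hq1 hv
  have hq : (1 - q) ≠ 0 := (sub_pos.2 hq1).ne'
  obtain ⟨C, hC0, hC⟩ := exists_abs_normalizedJ_zpow_le hq0 hq1 hv
  -- The part of the integrand independent of `i`. It is summable and the remaining factor is
  -- bounded, which yields all convergence claims and the interchange of sums.
  set h : ℤ → ℝ := fun r => (besselNorm q v ^ 2)⁻¹ * (q ^ v) ^ (-m - k) *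
    (q ^ (2 * r) * (besselInt q (q ^ v) (m + r) * besselInt q (q ^ v) (k + r))) with hdef
  have hh : Summable h :=
    (summable_zpow_mul_besselInt_mul hq0 hq1 hx (rpow_mul_self_lt_one hq0 hq1 hv) m k).mul_left _
  have hker : ∀ l r : ℤ, q ^ r * kernelIntegrand q v (q ^ m) (q ^ l) (q ^ k) (q ^ r)
      = h r * normalizedJ v (q ^ (l + r)) (q ^ 2) := fun l r =>
    zpow_mul_kernelIntegrand hq0 hq1 hv m l k r
  have hs : Summable (Function.uncurry fun (i : ℕ) (r : ℤ) =>
      sonineCoeff q v i * (h r * normalizedJ v (q ^ ((i : ℤ) + n + r)) (q ^ 2))) := by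
    refine Summable.of_norm_bounded
      (((summable_sonineCoeff hq0 hq1 hv).norm.mul_norm hh.norm).mul_right C) fun z => ?_
    rw [Function.uncurry, ← mul_assoc, norm_mul]
    exact mul_le_mul_of_nonneg_left (hC _) (norm_nonneg _)
  have hterm : ∀ i : ℕ, qPoch (q ^ (-2 * v)) (q ^ 2) i / qPoch (q ^ 2) (q ^ 2) i *
      q ^ ((i : ℝ) * (2 + 2 * v)) * translationKernel q v (q ^ m) (q ^ ((i : ℤ) + n)) (q ^ k)
      = cConst q v ^ 2 * (1 - q) * ∑' r : ℤ,
        sonineCoeff q v i * (h r * normalizedJ v (q ^ ((i : ℤ) + n + r)) (q ^ 2)) := by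
    intro i
    rw [translationKernel, jacksonIntegral, tsum_congr (hker _), tsum_mul_left, sonineCoeff]
    ring
  refine ⟨fun i => ?_, ?_, ?_⟩
  · rw [JacksonIntegrable]
    refine Summable.of_norm_bounded (hh.norm.mul_right C) fun r => ?_
    rw [hker, norm_mul]
    exact mul_le_mul_of_nonneg_left (hC _) (norm_nonneg _)
  · rw [summable_congr hterm]
    exact hs.prod.mul_left _
  · have hsonine : ∀ r : ℤ, ∑' i : ℕ,
        sonineCoeff q v i * (h r * normalizedJ v (q ^ ((i : ℤ) + n + r)) (q ^ 2))
        = (besselNorm q v ^ 3)⁻¹ * (q ^ v) ^ (-m - k) *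
          (q ^ (2 * r) * (besselInt q (q ^ v) (m + r) * besselInt q (q ^ v) (k + r))
            * besselInt q (q ^ (n + r)) 0) := by
      intro r
      have e := tsum_sonineCoeff_mul_normalizedJ hq0 hq1 hv (zpow_pos hq0 (n + r))
      rw [normalizedJ_zero_order hq0 hq1] at e
      have e' : ∀ i : ℕ, sonineCoeff q v i * (h r * normalizedJ v (q ^ ((i : ℤ) + n + r)) (q ^ 2))
          = h r * (sonineCoeff q v i * normalizedJ v (q ^ i * q ^ (n + r)) (q ^ 2)) := fun i => by
        rw [add_assoc, zpow_add₀ hq0.ne' (i : ℤ), zpow_natCast]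
        ring
      rw [tsum_congr e', tsum_mul_left, e, hdef]
      ring
    -- The constants match: `c_{q,v}² (1-q)² N⁻³ = N⁻¹`, the prefactor in `grafKernel_self`.
    rw [tsum_congr hterm, tsum_mul_left, ← hs.tsum_comm, tsum_congr hsonine, tsum_mul_left,
      tsum_zpow_mul_besselInt_mul_zero hq0 hq1 hv, grafKernel_self hq0 hq1, cConst_eq hq0]
    field_simp
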